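/- Let $H$ be a monotone mountain: a simple polygon with $k\ge 3$ vertices $a_1,\dots,a_k$ in circular order whose $x$-coordinates increase strictly; the edge $a_1a_k$ is its base. Assume that no three vertices of $H$ are collinear. The counterclockwise order of the vertices, started so that it runs from one endpoint of the base to the other, is $a_k,a_{k-1},\dots,a_1$ if $H$ lies above its base, and $a_1,a_2,\dots,a_k$ if $H$ lies below it. Let $r$ be its last vertex (so $r=a_1$ if $H$ lies above its base, and $r=a_k$ otherwise). The shortest path tree of $H$ with root $r$ is the union of the shortest polygonal chains inside the closed region bounded by $H$ from $r$ to the vertices of $H$. A triangulation of $H$ is a set of nondegenerate triangles with vertices among those of $H$ that cover exactly this region, any two different ones meeting exactly in the convex hull of their common vertices. In an angular sweep around a vertex $s$, the segment from $s$ to a point $t$ (where the segment lies inside $H$, and $t$ is the intersection point of a line through $s$ and another vertex with a line through two vertices) is turned around $s$ by moving $t$ in a given direction along the latter line; the answer is the first vertex that the segment hits after it has left its initial position. A constant-work-space algorithm is a fixed finite program with a fixed number of registers, both independent of $H$ and $k$, each register holding a pointer to a vertex of $H$. In unit time it can copy a register, test two pointers for equality, compare the $x$-coordinates of two vertices, test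 whether three vertices make a left turn, output a triangle, report a visited vertex, and advance a read-only scan of $H$ to the next vertex in counterclockwise order. It can also perform angular sweeps, which are counted separately. Initially it knows the two endpoints of the base, and the scan stands at the first vertex of the counterclockwise order. There are such an algorithm and a constant $C$ with the following property. For every monotone mountain $H$ with $k$ vertices, no three of them collinear, the algorithm halts; it makes exactly one counterclockwise scan of $H$ (from the first to the last vertex of the order above); it uses at most $Ck$ angular sweeps and at most $Ck$ units of additional time; the triangles that it outputs are exactly the triangles of a triangulation of $H$, each output exactly once; and the sequence of vertices that it visits is the Euler tour of the shortest path tree of $H$ with root $r$ in which the children of each vertex are visited in counterclockwise order. -/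

import Mathlib

namespace Mountain

/-! ### Polygons and mountains -/

/-- The Euclidean plane. -/
abbrev Plane : Type := EuclideanSpace ℝ (Fin 2)

/-- Twice the signed area of the triangle `p q r`; it is positive iff `p`, `q`, `r` make a left turn. -/
def orient (p q r : Plane) : ℝ :=
  (q 0 - p 0) * (r 1 - p 1) - (q 1 - p 1) * (r 0 - p 0)

/-- The `i`-th edge of the closed polygon `a`, joining `a i` to its cyclic successor. -/
def edge {k : ℕ} (a : Fin k → Plane) (i : Fin k) : Set Plane :=
  segment ℝ (a i) (a (finRotate k i))

/-- A simple polygon: distinct vertices, and two different edges meet at most in a common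
endpoint. -/
structure IsSimplePolygon {k : ℕ} (a : Fin k → Plane) : Prop where
  three_le : 3 ≤ k
  injective : Function.Injective a
  edge_inter : ∀ i j : Fin k, i ≠ j →
    edge a i ∩ edge a j ⊆ {a i, a (finRotate k i)} ∩ {a j, a (finRotate k j)}

/-- A monotone mountain: a simple polygon whose vertices, in circular order, have increasing
`x`-coordinates. The base is the edge from the last vertex back to the first one; the polygon may
lie on either side of it. -/
structure IsMountain {k : ℕ} (a : Fin k → Plane) : Prop where
  simple : IsSimplePolygon a
  monotone : StrictMono fun i => a i 0

/-- No three vertices lie on a line. -/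
def InGeneralPosition {k : ℕ} (a : Fin k → Plane) : Prop :=
  ∀ i j l : Fin k, i ≠ j → i ≠ l → j ≠ l → ¬ Collinear ℝ {a i, a j, a l}

/-- The boundary curve of the polygon. -/
def boundary {k : ℕ} (a : Fin k → Plane) : Set Plane :=
  ⋃ i, edge a i

/-- The closed region enclosed by the polygon: the boundary together with the bounded components
of its complement. -/
def region {k : ℕ} (a : Fin k → Plane) : Set Plane :=
  boundary a ∪
    {x | x ∈ (boundary a)ᶜ ∧ Bornology.IsBounded (connectedComponentIn (boundary a)ᶜ x)}

/-- Twice the signed area of the polygon (shoelace formula); positive iff the vertex order is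
counterclockwise. -/
def signedArea {k : ℕ} (a : Fin k → Plane) : ℝ :=
  ∑ i, (a i 0 * a (finRotate k i) 1 - a i 1 * a (finRotate k i) 0)

open scoped Classical in
/-- The counterclockwise order of the vertices of a mountain, from one endpoint of the base to the
other: the identity if the vertices are given counterclockwise, and the reversed order if not. -/
noncomputable def ccw {k : ℕ} (a : Fin k → Plane) : Fin k → Fin k :=
  if 0 < signedArea a then id else Fin.rev

/-- The first vertex of the counterclockwise order. -/
noncomputable def scanStart {k : ℕ} [NeZero k] (a : Fin k → Plane) : Fin k := ccw a 0

/-- The last vertex of the counterclockwise order; it is the left endpoint of the base if the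
mountain lies above its base, and the right one otherwise. The base joins `root a` and
`scanStart a`. -/
noncomputable def root {k : ℕ} [NeZero k] (a : Fin k → Plane) : Fin k := ccw a (Fin.rev 0)

/-! ### Triangulations -/

/-- `T`, a set of triples of vertices, is (the set of triangles of) a triangulation of the
polygon `a`: the triangles are nondegenerate, cover exactly the region of the polygon, and two
different triangles meet exactly in the convex hull of their common vertices. -/
structure IsTriangulation {k : ℕ} (a : Fin k → Plane) (T : Set (Finset (Fin k))) : Prop where
  card_eq : ∀ t ∈ T, t.card = 3
  nondegenerate : ∀ t ∈ T, AffineIndependent ℝ fun i : t => a i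
  cover : ⋃ t ∈ T, convexHull ℝ (a '' (t : Set (Fin k))) = region a
  inter : ∀ t ∈ T, ∀ t' ∈ T, t ≠ t' →
    convexHull ℝ (a '' (t : Set (Fin k))) ∩ convexHull ℝ (a '' (t' : Set (Fin k))) =
      convexHull ℝ (a '' ((t ∩ t' : Finset (Fin k)) : Set (Fin k)))

/-! ### The shortest path tree and its Euler tour -/

/-- `L` is a polygonal chain from `s` to `t` inside `R`. -/
def IsPathIn (R : Set Plane) (s t : Plane) (L : List Plane) : Prop :=
  L.head? = some s ∧ L.getLast? = some t ∧ L.IsChain fun p q => segment ℝ p q ⊆ R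

/-- The Euclidean length of a polygonal chain. -/
noncomputable def pathLength (L : List Plane) : ℝ :=
  (List.zipWith dist L L.tail).sum

/-- `L` is a shortest polygonal chain from `s` to `t` inside `R`. -/
def IsShortestPath (R : Set Plane) (s t : Plane) (L : List Plane) : Prop :=
  IsPathIn R s t L ∧ ∀ L', IsPathIn R s t L' → pathLength L ≤ pathLength L'

/-- `v` is a child of `u` in the shortest path tree of the polygon `a` with root `r`: some
shortest path inside the polygon from `r` to a vertex `m` goes directly from `u` to `v`. -/
def IsChild {k : ℕ} (a : Fin k → Plane) (r u v : Fin k) : Prop :=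
  u ≠ v ∧ ∃ m L, IsShortestPath (region a) (a r) (a m) L ∧ [a u, a v] <:+: L

/-- `cs` lists all children of `u` in the shortest path tree with root `r`, once each, in
counterclockwise order around `u`. -/
def IsChildList {k : ℕ} (a : Fin k → Plane) (r u : Fin k) (cs : List (Fin k)) : Prop :=
  (∀ v, v ∈ cs ↔ IsChild a r u v) ∧ cs.Pairwise fun v w => 0 < orient (a u) (a v) (a w)

/-- `TourThrough a r u cs t`: the vertex sequence `t` starts and ends in `u` and consists, for
each `c` in `cs` in this order, of a step from `u` down to `c`, the counterclockwise Euler tour of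
the whole subtree of `c`, and a step back to `u`. -/
inductive TourThrough {k : ℕ} (a : Fin k → Plane) (r : Fin k) :
    Fin k → List (Fin k) → List (Fin k) → Prop
  | nil (u : Fin k) : TourThrough a r u [] [u]
  | cons (u c : Fin k) (cs cs' t t' : List (Fin k)) :
      IsChildList a r c cs' → TourThrough a r c cs' t → TourThrough a r u cs t' →
      TourThrough a r u (c :: cs) (u :: (t ++ t'))

/-- `t` is the vertex sequence of the Euler tour of the shortest path tree of `a` with root `r`
that visits the children of each vertex in counterclockwise order. Each tree edge is traversed
exactly twice, once in each direction. -/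
def IsEulerTour {k : ℕ} (a : Fin k → Plane) (r : Fin k) (t : List (Fin k)) : Prop :=
  ∃ cs, IsChildList a r r cs ∧ TourThrough a r r cs t

/-! ### Angular sweeps -/

/-- The segment from the vertex `a s` to a point `t` is swept around `a s` while its other end moves
along the ray from `t` in direction `d`; `a j` is the first vertex that it hits. -/
def IsFirstHit {k : ℕ} (a : Fin k → Plane) (s : Fin k) (t d : Plane) (j : Fin k) : Prop :=
  j ≠ s ∧ ∃ x : ℝ, 0 < x ∧ a j ∈ segment ℝ (a s) (t + x • d) ∧
    ∀ (i : Fin k) (y : ℝ), i ≠ s → 0 < y → a i ∈ segment ℝ (a s) (t + y • d) → x ≤ y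

/-- The angular sweep around `a s` that starts at the point where the line through `a s` and `a w`
meets the line through `a e` and `a e'`, and moves its end in the direction from `a e` to `a e'`,
first hits `a j`. The lines must meet in one point, and the initial segment must lie inside the
polygon. -/
def SweepHits {k : ℕ} (a : Fin k → Plane) (s w e e' j : Fin k) : Prop :=
  ∃ t : Plane, (line[ℝ, a s, a w] : Set Plane) ∩ (line[ℝ, a e, a e'] : Set Plane) = {t} ∧
    segment ℝ (a s) t ⊆ region a ∧ IsFirstHit a s t (a e' - a e) j

open scoped Classical in
/-- The answer to an angular sweep, if it is well defined. -/
noncomputable def sweep {k : ℕ} (a : Fin k → Plane) (s w e e' : Fin k) : Option (Fin k) :=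
  if h : ∃! j, SweepHits a s w e e' j then some h.choose else none

/-! ### The constant-work-space machine -/

/-- The instructions of a machine with `m` registers, each of which holds a pointer to a vertex of
the input. Jump targets are positions in the program. -/
inductive Instr (m : ℕ) where
  /-- copy a register -/
  | copy (dst src : Fin m)
  /-- jump if two registers point to the same vertex -/
  | jumpEq (x y : Fin m) (target : ℕ)
  /-- jump if the first vertex lies to the left of the second one -/
  | jumpLt (x y : Fin m) (target : ℕ)
  /-- jump if three vertices make a left turn -/
  | jumpLeft (x y z : Fin m) (target : ℕ)
  /-- move the scan head to the next vertex in counterclockwise order and load it -/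
  | advance (dst : Fin m)
  /-- perform an angular sweep around `s` and load the first vertex hit -/
  | sweep (dst s w e e' : Fin m)
  /-- output a triangle -/
  | output (x y z : Fin m)
  /-- report that the tour is at this vertex -/
  | visit (x : Fin m)
  /-- stop -/
  | halt

/-- A program is a finite list of instructions. The program and its number `m` of registers do not
depend on the input. -/
abbrev Program (m : ℕ) : Type := List (Instr m)

/-- A configuration of a machine with `m` registers on an input with `k` vertices. The work-space
consists of the program counter and the registers; the scan head belongs to the input,
and the remaining fields only record what has happened. -/
structure Config (m k : ℕ) where
  pc : ℕ
  reg : Fin m → Fin k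
  /-- position of the scan head in the counterclockwise order -/
  head : Fin k
  /-- number of angular sweeps so far -/
  sweeps : ℕ
  /-- number of all other instructions so far -/
  time : ℕ
  /-- triangles output so far, in order -/
  out : List (Fin k × Fin k × Fin k)
  /-- vertices visited by the tour so far, in order -/
  tour : List (Fin k)

/-- Initially register `0` holds the endpoint `root a` of the base and the other registers hold
its endpoint `scanStart a`, where the scan head stands. -/
noncomputable def Config.start (m : ℕ) {k : ℕ} [NeZero k] (a : Fin k → Plane) : Config m k where
  pc := 0
  reg i := if i.val = 0 then root a else scanStart a
  head := 0
  sweeps := 0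
  time := 0
  out := []
  tour := []

/-- Proceed to the instruction at `pc`, charging one unit of time. -/
def Config.goto {m k : ℕ} (c : Config m k) (pc : ℕ) : Config m k :=
  { c with pc := pc, time := c.time + 1 }

open scoped Classical in
/-- The effect of one instruction; `none` means that the machine stops or is stuck (after the last
instruction, at an attempt to move the scan head past the last vertex, or at an ill-defined
sweep). -/
noncomputable def step {m k : ℕ} (P : Program m) (a : Fin k → Plane) (c : Config m k) :
    Option (Config m k) :=
  match P[c.pc]? with
  | none => none
  | some (.copy dst src) =>
      some { c.goto (c.pc + 1) with reg := Function.update c.reg dst (c.reg src) }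
  | some (.jumpEq x y l) =>
      some (c.goto (if c.reg x = c.reg y then l else c.pc + 1))
  | some (.jumpLt x y l) =>
      some (c.goto (if a (c.reg x) 0 < a (c.reg y) 0 then l else c.pc + 1))
  | some (.jumpLeft x y z l) =>
      some (c.goto (if 0 < orient (a (c.reg x)) (a (c.reg y)) (a (c.reg z)) then l else c.pc + 1))
  | some (.advance dst) =>
      if h : c.head.val + 1 < k then
        some { c.goto (c.pc + 1) with
          head := ⟨c.head.val + 1, h⟩
          reg := Function.update c.reg dst (ccw a ⟨c.head.val + 1, h⟩) }
      else none
  | some (.sweep dst s w e e') =>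
      (sweep a (c.reg s) (c.reg w) (c.reg e) (c.reg e')).map fun j =>
        { c with
          pc := c.pc + 1
          sweeps := c.sweeps + 1
          reg := Function.update c.reg dst j }
  | some (.output x y z) =>
      some { c.goto (c.pc + 1) with out := c.out ++ [(c.reg x, c.reg y, c.reg z)] }
  | some (.visit x) =>
      some { c.goto (c.pc + 1) with tour := c.tour ++ [c.reg x] }
  | some .halt => none

/-- The program `P`, run on the polygon `a`, stops at a `halt` instruction in configuration `c`. -/
def HaltsAt {m k : ℕ} [NeZero k] (P : Program m) (a : Fin k → Plane) (c : Config m k) : Prop :=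
  Relation.ReflTransGen (fun c₁ c₂ => step P a c₁ = some c₂) (Config.start m a) c ∧
    P[c.pc]? = some Instr.halt

/-- The triangles output in configuration `c`, as sets of vertices. -/
def Config.triangles {m k : ℕ} (c : Config m k) : List (Finset (Fin k)) :=
  c.out.map fun t => {t.1, t.2.1, t.2.2}

end Mountain

/-!
Up to half a turn (a sign `σ`, which preserves orientation) a mountain lies above its base, which
goes from the leftmost vertex `r`, the root, to the rightmost vertex `s`; the counterclockwise scan
goes from right to left (`IsMountain.exists_upright`). The region is the set of points above the base
and below the chain (`Upright.region_eq`).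

**The tree.** The base never obstructs a shortest path from `r`, so the path to a vertex `v` is the
lower convex hull of the vertices up to `v`. Hence the parent of `v` is the vertex `u` to the left
of `v` for which the line `u v` passes below all other vertices to the left of `v` (`Par`,
`Upright.isChild_iff`). The lower bound on path lengths comes from supporting directions: a path that
ends to the right of `u` is cut where it crosses the vertical line through `u`, where it passes below
`u` (`Upright.exists_dist`); the strict form of this bound shows that no other edges occur.
The counterclockwise order of the children of a vertex is from right to left, and the postorder
of the tree is the order of the scan.

**The algorithm.** Let the tour have completed the subtree of `j`, let `u` be the parent of `j` and
`n` the vertex next to the left of `j`. If `n = u`, then the tour has completed `u`, and one sweep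
around `u`, starting from the extension of the edge `u j` to the base, finds the parent of `u`
(`Upright.sweep_par`). If not, then `n` is a leaf, and the tree path from `u` down to `n` together
with `j` bounds a funnel: a convex chain all of whose edges are visible from `j`. One sweep around
each vertex of this chain, from `j` towards `n`, finds the next one (`Upright.sweep_lowest`), and
the triangle that it spans with the edge of the chain is output.

**The triangulation.** At all times the triangles output so far triangulate the region between the
base and the chain that consists of the tree path to the current vertex and of all vertices
from `j` on (`chain`, `Triangulates`). The next triangle is glued to an edge of this chain
(`Upright.triangulates_insert`); in the beginning the chain is the base, and in the end it passes
through all vertices.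

**Resources.** Each sweep either outputs a triangle, and thereby adds a vertex to the chain, or is
followed by an advance of the scan.
-/

namespace Mountain

/-! ### Orientation and coordinates -/

/-- The `x`-coordinate after the plane has been turned by `σ = 1` (no turn) or `σ = -1` (half a turn). -/
def xc (σ : ℝ) (p : Plane) : ℝ := σ * p 0

/-- The `y`-coordinate after the plane has been turned by `σ = 1` (no turn) or `σ = -1` (half a turn). -/
def yc (σ : ℝ) (p : Plane) : ℝ := σ * p 1

theorem plane_ext {p q : Plane} (h0 : p 0 = q 0) (h1 : p 1 = q 1) : p = q := by
  ext i; fin_cases i <;> assumption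

theorem orient_rot (p q z : Plane) : orient p q z = orient q z p := by
  unfold orient; ring

theorem orient_swap (p q z : Plane) : orient p q z = -orient q p z := by
  unfold orient; ring

theorem orient_swap' (p q z : Plane) : orient p q z = -orient p z q := by
  unfold orient; ring

@[simp] theorem orient_self_left (p z : Plane) : orient p p z = 0 := by unfold orient; ring
@[simp] theorem orient_self_right (p q : Plane) : orient p q q = 0 := by unfold orient; ring
@[simp] theorem orient_self_outer (p q : Plane) : orient p q p = 0 := by unfold orient; ring

/-- For `p` to the left of `q`, `z` and `w`, this compares the slopes of `q`, `z` and `w` seen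
from `p`. -/
theorem orient_slope (σ : ℝ) (p q z w : Plane) :
    (xc σ z - xc σ p) * orient p q w =
      (xc σ q - xc σ p) * orient p z w + (xc σ w - xc σ p) * orient p q z := by
  unfold orient xc; ring

theorem orient_line (p q z w : Plane) (t : ℝ) :
    orient p q (z + t • (w - z)) = (1 - t) * orient p q z + t * orient p q w := by
  unfold orient; simp; ring

theorem xc_line (σ : ℝ) (z w : Plane) (t : ℝ) :
    xc σ (z + t • (w - z)) = xc σ z + t * (xc σ w - xc σ z) := by
  unfold xc; simp; ring

theorem orient_xy {σ : ℝ} (h : σ * σ = 1) (p q z : Plane) :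
    orient p q z = (xc σ q - xc σ p) * (yc σ z - yc σ p) - (yc σ q - yc σ p) * (xc σ z - xc σ p) := by
  unfold orient xc yc; linear_combination (-(q 0 - p 0) * (z 1 - p 1) + (q 1 - p 1) * (z 0 - p 0)) * h

theorem plane_ext_xy {σ : ℝ} (h : σ * σ = 1) {p q : Plane} (hx : xc σ p = xc σ q)
    (hy : yc σ p = yc σ q) : p = q := by
  have h0 : σ ≠ 0 := by rintro rfl; simp at h
  exact plane_ext (mul_left_cancel₀ h0 hx) (mul_left_cancel₀ h0 hy)

theorem mem_segment_line {p q z : Plane} :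
    z ∈ segment ℝ p q ↔ ∃ t : ℝ, 0 ≤ t ∧ t ≤ 1 ∧ z = p + t • (q - p) := by
  rw [segment_eq_image']
  constructor
  · rintro ⟨t, ht, rfl⟩; exact ⟨t, ht.1, ht.2, rfl⟩
  · rintro ⟨t, h0, h1, rfl⟩; exact ⟨t, ⟨h0, h1⟩, rfl⟩

/-- A point is determined by its orientation with respect to a non-vertical line and its
`x`-coordinate. -/
theorem eq_line_of_orient {σ : ℝ} (h : σ * σ = 1) {p q z : Plane} (hpq : xc σ p ≠ xc σ q)
    (ho : orient p q z = 0) :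
    z = p + ((xc σ z - xc σ p) / (xc σ q - xc σ p)) • (q - p) := by
  have h0 : σ ≠ 0 := by rintro rfl; simp at h
  have hd : q 0 - p 0 ≠ 0 := fun e => hpq (by unfold xc; rw [sub_eq_zero.1 e])
  have e : (xc σ z - xc σ p) / (xc σ q - xc σ p) = (z 0 - p 0) / (q 0 - p 0) := by
    unfold xc; rw [← mul_sub, ← mul_sub, mul_div_mul_left _ _ h0]
  rw [e]
  unfold orient at ho
  apply plane_ext
  · simp; field_simp; ring
  · simp; field_simp; linarith

theorem mem_segment_of_orient {σ : ℝ} (h : σ * σ = 1) {p q z : Plane} (hpq : xc σ p < xc σ q)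
    (ho : orient p q z = 0) (h1 : xc σ p ≤ xc σ z) (h2 : xc σ z ≤ xc σ q) :
    z ∈ segment ℝ p q := by
  rw [mem_segment_line]
  refine ⟨_, ?_, ?_, eq_line_of_orient h hpq.ne ho⟩
  · exact div_nonneg (by linarith) (by linarith)
  · rw [div_le_one (by linarith)]; linarith

theorem orient_of_mem_segment {p q z : Plane} (h : z ∈ segment ℝ p q) : orient p q z = 0 := by
  obtain ⟨t, -, -, rfl⟩ := mem_segment_line.1 h
  rw [orient_line]; simp

theorem xc_mem_segment {σ : ℝ} {p q z : Plane} (h : z ∈ segment ℝ p q) (hpq : xc σ p ≤ xc σ q) :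
    xc σ p ≤ xc σ z ∧ xc σ z ≤ xc σ q := by
  obtain ⟨t, h0, h1, rfl⟩ := mem_segment_line.1 h
  rw [xc_line]; constructor <;> nlinarith

theorem orient_nonneg_segment {p q u v z : Plane} (h : z ∈ segment ℝ u v)
    (hu : 0 ≤ orient p q u) (hv : 0 ≤ orient p q v) : 0 ≤ orient p q z := by
  obtain ⟨t, h0, h1, rfl⟩ := mem_segment_line.1 h
  rw [orient_line]
  have := mul_nonneg (sub_nonneg.2 h1) hu
  have := mul_nonneg h0 hv
  linarith

theorem continuous_xc (σ : ℝ) : Continuous (xc σ) := by unfold xc; fun_prop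

theorem continuous_orient (p q : Plane) : Continuous (orient p q) := by
  unfold orient; fun_prop

theorem convex_orient_nonneg (p q : Plane) : Convex ℝ {z | 0 ≤ orient p q z} := by
  rw [convex_iff_segment_subset]
  intro u hu v hv z hz
  exact orient_nonneg_segment hz hu hv

theorem convex_orient_nonpos (p q : Plane) : Convex ℝ {z | orient p q z ≤ 0} := by
  have e : {z | orient p q z ≤ 0} = {z | 0 ≤ orient q p z} := by
    ext z; simp [orient_swap p q z]
  rw [e]
  exact convex_orient_nonneg q p

theorem convex_xc_mem (σ l u : ℝ) : Convex ℝ {z | l ≤ xc σ z ∧ xc σ z ≤ u} := by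
  rw [convex_iff_segment_subset]
  rintro p ⟨h1, h2⟩ q ⟨h3, h4⟩ z hz
  obtain ⟨t, h0, h1', rfl⟩ := mem_segment_line.1 hz
  constructor
  · rw [xc_line]; nlinarith
  · rw [xc_line]; nlinarith

theorem orient_sum {ι : Type*} [Fintype ι] (p q : Plane) (w : ι → ℝ) (z : ι → Plane)
    (hw : ∑ i, w i = 1) : orient p q (∑ i, w i • z i) = ∑ i, w i * orient p q (z i) := by
  have e : ∀ i, w i * orient p q (z i) = (q 0 - p 0) * (w i * z i 1) -
      (q 1 - p 1) * (w i * z i 0) - w i * ((q 0 - p 0) * p 1 - (q 1 - p 1) * p 0) := by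
    intro i; unfold orient; ring
  simp only [e, Finset.sum_sub_distrib, ← Finset.mul_sum, ← Finset.sum_mul, hw]
  unfold orient
  simp [WithLp.ofLp_sum, Finset.sum_apply]
  ring

/-- The part of a convex hull on a supporting line is the hull of the points on that line. -/
theorem mem_convexHull_of_orient_eq_zero {A : Set Plane} {p q z : Plane}
    (hz : z ∈ convexHull ℝ A) (hA : ∀ y ∈ A, orient p q y ≤ 0) (ho : orient p q z = 0) :
    z ∈ convexHull ℝ {y ∈ A | orient p q y = 0} := by
  classical
  obtain ⟨ι, _, w, f, hw0, hw1, hf, rfl⟩ := mem_convexHull_iff_exists_fintype.1 hz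
  rw [orient_sum _ _ _ _ hw1] at ho
  have hz0 : ∀ i, w i * orient p q (f i) = 0 := by
    have := (Finset.sum_eq_zero_iff_of_nonpos
      (fun i _ => mul_nonpos_of_nonneg_of_nonpos (hw0 i) (hA _ (hf i)))).1 ho
    exact fun i => this i (Finset.mem_univ i)
  obtain ⟨i0, hi0⟩ : ∃ i, w i ≠ 0 := by
    by_contra! h
    simp [h] at hw1
  -- points of weight zero are replaced by a fixed point of positive weight
  refine mem_convexHull_of_exists_fintype w (fun i => if w i = 0 then f i0 else f i) hw0 hw1 ?_ ?_
  · intro i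
    split_ifs with h
    · exact ⟨hf i0, (mul_eq_zero.1 (hz0 i0)).resolve_left hi0⟩
    · exact ⟨hf i, (mul_eq_zero.1 (hz0 i)).resolve_left h⟩
  · refine Finset.sum_congr rfl fun i _ => ?_
    split_ifs with h
    · simp [h]
    · rfl

/-- Barycentric coordinates: a point on the inner side of each edge of a clockwise triangle lies in it. -/
theorem mem_convexHull_triple {p q w z : Plane} (h : orient p q w < 0) (h1 : orient p q z ≤ 0)
    (h2 : orient q w z ≤ 0) (h3 : orient w p z ≤ 0) : z ∈ convexHull ℝ {p, q, w} := by
  refine mem_convexHull_of_exists_fintype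
    ![orient q w z / orient p q w, orient w p z / orient p q w, orient p q z / orient p q w]
    ![p, q, w] ?_ ?_ ?_ ?_
  · intro i
    fin_cases i
    · exact div_nonneg_of_nonpos h2 h.le
    · exact div_nonneg_of_nonpos h3 h.le
    · exact div_nonneg_of_nonpos h1 h.le
  · simp [Fin.sum_univ_three]
    rw [← add_div, ← add_div, div_eq_one_iff_eq h.ne]
    unfold orient; ring
  · intro i; fin_cases i <;> simp
  · have hne := h.ne
    simp only [Fin.sum_univ_three]
    apply plane_ext
    · simp; field_simp; unfold orient; ring
    · simp; field_simp; unfold orient; ring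

theorem collinear_of_orient_eq_zero {p q z : Plane} (h : orient p q z = 0) :
    Collinear ℝ {p, q, z} := by
  by_cases hpq : p = q
  · subst hpq
    simpa using collinear_pair ℝ p z
  rw [collinear_iff_of_mem (p₀ := p) (by simp)]
  refine ⟨q - p, ?_⟩
  have hs : q 0 - p 0 ≠ 0 ∨ q 1 - p 1 ≠ 0 := by
    by_contra! hc
    exact hpq (plane_ext (by linarith [hc.1]) (by linarith [hc.2]))
  unfold orient at h
  intro x hx
  simp only [Set.mem_insert_iff, Set.mem_singleton_iff] at hx
  rcases hx with rfl | rfl | rfl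
  · exact ⟨0, by simp⟩
  · exact ⟨1, by simp⟩
  · rcases hs with hs | hs
    · refine ⟨(x 0 - p 0) / (q 0 - p 0), plane_ext ?_ ?_⟩
      · simp; field_simp; ring
      · simp; field_simp; linarith
    · refine ⟨(x 1 - p 1) / (q 1 - p 1), plane_ext ?_ ?_⟩
      · simp; field_simp; linarith
      · simp; field_simp; ring

theorem orient_eq_zero_of_collinear {p q z : Plane} (h : Collinear ℝ {p, q, z}) :
    orient p q z = 0 := by
  rw [collinear_iff_of_mem (p₀ := p) (by simp)] at h
  obtain ⟨v, hv⟩ := h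
  obtain ⟨s, hs⟩ := hv q (by simp)
  obtain ⟨t, ht⟩ := hv z (by simp)
  rw [hs, ht]
  unfold orient
  simp; ring

theorem orient_of_mem_line {p q z : Plane} (h : z ∈ line[ℝ, p, q]) : orient p q z = 0 := by
  apply orient_eq_zero_of_collinear
  have := collinear_insert_of_mem_affineSpan_pair h
  convert this using 1
  ext x; simp; tauto

theorem mem_line_of_orient {σ : ℝ} (h : σ * σ = 1) {p q z : Plane} (hpq : xc σ p ≠ xc σ q)
    (ho : orient p q z = 0) : z ∈ line[ℝ, p, q] := by
  rw [eq_line_of_orient h hpq ho]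
  have := AffineMap.lineMap_mem_affineSpan_pair ((xc σ z - xc σ p) / (xc σ q - xc σ p)) p q
  rwa [AffineMap.lineMap_apply, vsub_eq_sub, vadd_eq_add, add_comm] at this

/-! ### The region below a chain -/

/-- The polygon `a`, turned by `σ`, is a mountain above its base, which goes from the leftmost
vertex `r` to the rightmost vertex `s`; no three vertices are collinear. -/
structure Upright {k : ℕ} (a : Fin k → Plane) (σ : ℝ) (r s : Fin k) : Prop where
  sq : σ * σ = 1
  inj : ∀ i j, xc σ (a i) = xc σ (a j) → i = j
  left : ∀ i, xc σ (a r) ≤ xc σ (a i)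
  right : ∀ i, xc σ (a i) ≤ xc σ (a s)
  ne : r ≠ s
  above : ∀ i, i ≠ r → i ≠ s → 0 < orient (a r) (a s) (a i)
  gp : ∀ i j l, i ≠ j → i ≠ l → j ≠ l → orient (a i) (a j) (a l) ≠ 0

/-- `i` and `j` are consecutive elements of `C` in the left-to-right order. -/
def Consec {k : ℕ} (a : Fin k → Plane) (σ : ℝ) (C : Set (Fin k)) (i j : Fin k) : Prop :=
  i ∈ C ∧ j ∈ C ∧ xc σ (a i) < xc σ (a j) ∧
    ∀ m ∈ C, xc σ (a m) ≤ xc σ (a i) ∨ xc σ (a j) ≤ xc σ (a m)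

/-- The closed region between the base and the `x`-monotone chain through the vertices in `C`. -/
def under {k : ℕ} (a : Fin k → Plane) (σ : ℝ) (r s : Fin k) (C : Set (Fin k)) : Set Plane :=
  {z | xc σ (a r) ≤ xc σ z ∧ xc σ z ≤ xc σ (a s) ∧ 0 ≤ orient (a r) (a s) z ∧
    ∀ i j, Consec a σ C i j → xc σ (a i) ≤ xc σ z → xc σ z ≤ xc σ (a j) →
      orient (a i) (a j) z ≤ 0}

/-- The triangle with vertices `t`. -/
def hull {k : ℕ} (a : Fin k → Plane) (t : Finset (Fin k)) : Set Plane :=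
  convexHull ℝ (a '' (t : Set (Fin k)))

variable {k : ℕ} {a : Fin k → Plane} {σ : ℝ} {r s : Fin k}

theorem Upright.xc_lt (M : Upright a σ r s) {i j : Fin k}
    (h : xc σ (a i) ≤ xc σ (a j)) (hne : i ≠ j) : xc σ (a i) < xc σ (a j) :=
  lt_of_le_of_ne h fun e => hne (M.inj _ _ e)

theorem ne_of_xc_lt {i j : Fin k} (h : xc σ (a i) < xc σ (a j)) : i ≠ j := by
  rintro rfl; exact lt_irrefl _ h

theorem Upright.base_nonneg (M : Upright a σ r s) (i : Fin k) :
    0 ≤ orient (a r) (a s) (a i) := by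
  by_cases h1 : i = r
  · simp [h1]
  by_cases h2 : i = s
  · simp [h2]
  exact (M.above i h1 h2).le

theorem Upright.lt_rs (M : Upright a σ r s) : xc σ (a r) < xc σ (a s) :=
  M.xc_lt (M.left s) M.ne

theorem Upright.exists_consec (M : Upright a σ r s) {C : Set (Fin k)} (hr : r ∈ C) (hs : s ∈ C)
    {z : Plane} (h1 : xc σ (a r) ≤ xc σ z) (h2 : xc σ z ≤ xc σ (a s)) :
    ∃ i j, Consec a σ C i j ∧ xc σ (a i) ≤ xc σ z ∧ xc σ z ≤ xc σ (a j) := by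
  obtain ⟨i, ⟨hiC, his, hiz⟩, hi⟩ := Set.exists_max_image
    {i | i ∈ C ∧ i ≠ s ∧ xc σ (a i) ≤ xc σ z} (fun i => xc σ (a i)) (Set.toFinite _) ⟨r, hr, M.ne, h1⟩
  obtain ⟨j, ⟨hjC, hij⟩, hj⟩ := Set.exists_min_image
    {j | j ∈ C ∧ xc σ (a i) < xc σ (a j)} (fun i => xc σ (a i)) (Set.toFinite _)
    ⟨s, hs, M.xc_lt (M.right i) his⟩
  refine ⟨i, j, ⟨hiC, hjC, hij, fun m hm => ?_⟩, hiz, ?_⟩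
  · by_contra! hc
    exact absurd (hj m ⟨hm, hc.1⟩) (not_le.2 hc.2)
  · by_cases hjs : j = s
    · rwa [hjs]
    · by_contra! hc
      exact absurd (hi j ⟨hjC, hjs, hc.le⟩) (not_le.2 hij)

/-- A segment that starts and ends in the region and passes below all vertices in between stays
in the region. -/
theorem Upright.segment_subset_under (M : Upright a σ r s) {C : Set (Fin k)} {p q : Plane}
    (hpq : xc σ p < xc σ q) (hp : p ∈ under a σ r s C) (hq : q ∈ under a σ r s C)
    (h : ∀ i ∈ C, xc σ p < xc σ (a i) → xc σ (a i) < xc σ q → 0 ≤ orient p q (a i)) :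
    segment ℝ p q ⊆ under a σ r s C := by
  intro z hz
  obtain ⟨hz1, hz2⟩ := xc_mem_segment hz hpq.le
  have hz0 := orient_of_mem_segment hz
  refine ⟨hp.1.trans hz1, hz2.trans hq.2.1, orient_nonneg_segment hz hp.2.2.1 hq.2.2.1, ?_⟩
  intro i j hij hiz hzj
  -- the chain edge is compared with the segment at the two ends of their common `x`-range
  obtain ⟨u, hu1, hu2, hu3, hu4⟩ : ∃ u, xc σ u ≤ xc σ z ∧ 0 ≤ orient p q u ∧
      orient (a i) (a j) u ≤ 0 ∧ (xc σ p ≤ xc σ u) := by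
    rcases lt_or_ge (xc σ p) (xc σ (a i)) with h1 | h1
    · refine ⟨a i, hiz, ?_, by simp, h1.le⟩
      rcases eq_or_lt_of_le (hiz.trans hz2) with h2 | h2
      · have e := hq.2.2.2 i j hij h2.le (by linarith [hij.2.2.1])
        rw [orient_xy M.sq] at e ⊢
        have := hij.2.2.1
        rw [h2] at e ⊢
        nlinarith
      · exact h i hij.1 h1 h2
    · exact ⟨p, hz1, by simp, hp.2.2.2 i j hij h1 (hz1.trans hzj), le_rfl⟩
  obtain ⟨v, hv1, hv2, hv3, hv4⟩ : ∃ v, xc σ z ≤ xc σ v ∧ 0 ≤ orient p q v ∧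
      orient (a i) (a j) v ≤ 0 ∧ (xc σ v ≤ xc σ q) := by
    rcases lt_or_ge (xc σ (a j)) (xc σ q) with h1 | h1
    · refine ⟨a j, hzj, ?_, by simp, h1.le⟩
      rcases eq_or_lt_of_le (hz1.trans hzj) with h2 | h2
      · have e := hp.2.2.2 i j hij (by linarith [hij.2.2.1]) h2.le
        rw [orient_xy M.sq] at e ⊢
        have := hij.2.2.1
        rw [← h2] at e ⊢
        nlinarith
      · exact h j hij.2.1 h2 h1
    · exact ⟨q, hz2, by simp, hq.2.2.2 i j hij (hiz.trans hz2) h1, le_rfl⟩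
  have hij' := hij.2.2.1
  rw [orient_xy M.sq] at hu2 hu3 hv2 hv3 hz0 ⊢
  set x1 := xc σ (a i); set x2 := xc σ (a j); set y1 := yc σ (a i); set y2 := yc σ (a j)
  set px := xc σ p; set py := yc σ p; set qx := xc σ q; set qy := yc σ q
  set zx := xc σ z; set zy := yc σ z; set ux := xc σ u; set uy := yc σ u
  set vx := xc σ v; set vy := yc σ v
  by_contra! hc
  have hd : 0 < qx - px := by linarith
  have hd' : 0 < x2 - x1 := by linarith
  have A : (qy - py) * (x2 - x1) * (ux - zx) ≤ (y2 - y1) * (qx - px) * (ux - zx) -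
      ((qx - px) * ((x2 - x1) * (zy - y1) - (y2 - y1) * (zx - x1))) := by
    nlinarith [mul_nonneg hd'.le hu2, mul_nonneg hd.le (neg_nonneg.2 hu3)]
  have B : (qy - py) * (x2 - x1) * (vx - zx) ≤ (y2 - y1) * (qx - px) * (vx - zx) -
      ((qx - px) * ((x2 - x1) * (zy - y1) - (y2 - y1) * (zx - x1))) := by
    nlinarith [mul_nonneg hd'.le hv2, mul_nonneg hd.le (neg_nonneg.2 hv3)]
  have P := mul_pos hd hc
  rcases le_total ((qy - py) * (x2 - x1)) ((y2 - y1) * (qx - px)) with h3 | h3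
  · nlinarith [mul_nonneg (sub_nonneg.2 h3) (sub_nonneg.2 hu1)]
  · nlinarith [mul_nonneg (sub_nonneg.2 h3) (sub_nonneg.2 hv1)]

theorem Upright.consec_insert (M : Upright a σ r s) {C : Set (Fin k)} {u v j : Fin k}
    (h : Consec a σ C u j) (huv : xc σ (a u) < xc σ (a v)) (hvj : xc σ (a v) < xc σ (a j))
    (i m : Fin k) :
    Consec a σ (insert v C) i m ↔
      (Consec a σ C i m ∧ (xc σ (a m) ≤ xc σ (a u) ∨ xc σ (a j) ≤ xc σ (a i))) ∨
        (i = u ∧ m = v) ∨ (i = v ∧ m = j) := by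
  obtain ⟨hu, hj, huj, hb⟩ := h
  constructor
  · rintro ⟨hi, hm, him, hc⟩
    have hcu := hc u (Or.inr hu)
    have hcj := hc j (Or.inr hj)
    have hcv := hc v (Or.inl rfl)
    rcases hi with rfl | hi
    · rcases hm with rfl | hm
      · exact absurd him (lt_irrefl _)
      · right; right
        refine ⟨rfl, M.inj _ _ ?_⟩
        rcases hb m hm with h1 | h1
        · linarith
        · rcases hcj with h2 | h2 <;> linarith
    · rcases hm with rfl | hm
      · right; left
        refine ⟨M.inj _ _ ?_, rfl⟩
        rcases hb i hi with h1 | h1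
        · rcases hcu with h2 | h2 <;> linarith
        · linarith
      · left
        refine ⟨⟨hi, hm, him, fun l hl => hc l (Or.inr hl)⟩, ?_⟩
        by_contra! hn
        rcases hb m hm with h1 | h1
        · linarith
        rcases hb i hi with h2 | h2
        · rcases hcv with h3 | h3 <;> linarith
        · linarith
  · rintro (⟨⟨hi, hm, him, hc⟩, h1⟩ | ⟨rfl, rfl⟩ | ⟨rfl, rfl⟩)
    · refine ⟨Or.inr hi, Or.inr hm, him, ?_⟩
      rintro l (rfl | hl)
      · rcases h1 with h1 | h1
        · right; linarith
        · left; linarith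
      · exact hc l hl
    · refine ⟨Or.inr hu, Or.inl rfl, huv, ?_⟩
      rintro l (rfl | hl)
      · right; rfl
      · rcases hb l hl with h1 | h1
        · left; exact h1
        · right; linarith
    · refine ⟨Or.inl rfl, Or.inr hj, hvj, ?_⟩
      rintro l (rfl | hl)
      · left; rfl
      · rcases hb l hl with h1 | h1
        · left; linarith
        · right; exact h1

/-- A pair of consecutive elements of `C` other than `u`, `j` lies on one side of it. -/
theorem Upright.consec_cases (M : Upright a σ r s) {C : Set (Fin k)} {u j i m : Fin k}
    (h : Consec a σ C u j) (h' : Consec a σ C i m) :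
    (i = u ∧ m = j) ∨ xc σ (a m) ≤ xc σ (a u) ∨ xc σ (a j) ≤ xc σ (a i) := by
  by_contra! hc
  obtain ⟨h1, h2, h3⟩ := hc
  have e1 := h.2.2.2 i h'.1
  have e2 := h.2.2.2 m h'.2.1
  have e3 := h'.2.2.2 u h.1
  have e4 := h'.2.2.2 j h.2.1
  have hi : i = u := M.inj _ _ (by
    rcases e1 with e1 | e1
    · rcases e3 with e3 | e3 <;> linarith
    · linarith)
  exact h1 hi (M.inj _ _ (by
    rcases e2 with e2 | e2
    · linarith
    · rcases e4 with e4 | e4 <;> linarith))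

theorem hull_triple (u v j : Fin k) : hull a {j, u, v} = convexHull ℝ {a u, a v, a j} := by
  unfold hull
  congr 1
  ext z; simp; tauto

theorem mem_hull_triple {u v j : Fin k} (huv : xc σ (a u) < xc σ (a v))
    (hvj : xc σ (a v) < xc σ (a j)) (ho : orient (a u) (a v) (a j) < 0) {z : Plane}
    (hz : z ∈ hull a {j, u, v}) :
    orient (a u) (a v) z ≤ 0 ∧ orient (a v) (a j) z ≤ 0 ∧ 0 ≤ orient (a u) (a j) z ∧
      xc σ (a u) ≤ xc σ z ∧ xc σ z ≤ xc σ (a j) := by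
  rw [hull_triple] at hz
  have key : ∀ S : Set Plane, Convex ℝ S → a u ∈ S → a v ∈ S → a j ∈ S → z ∈ S := by
    intro S hS h1 h2 h3
    refine convexHull_min ?_ hS hz
    rintro y (rfl | rfl | rfl) <;> assumption
  refine ⟨key _ (convex_orient_nonpos _ _) ?_ ?_ ?_, key _ (convex_orient_nonpos _ _) ?_ ?_ ?_,
    key _ (convex_orient_nonneg _ _) ?_ ?_ ?_, key _ (convex_xc_mem σ _ _) ?_ ?_ ?_⟩
  · simp
  · simp
  · exact ho.le
  · rw [Set.mem_ofPred_eq, ← orient_rot]; exact ho.le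
  · simp
  · simp
  · simp
  · rw [Set.mem_ofPred_eq, orient_swap']; linarith
  · simp
  · exact ⟨le_rfl, by linarith⟩
  · exact ⟨by linarith, by linarith⟩
  · exact ⟨by linarith, le_rfl⟩

/-- Inserting a vertex `v` into the chain adds the triangle over the edge that `v` replaces. -/
theorem Upright.under_insert (M : Upright a σ r s) {C : Set (Fin k)} {u v j : Fin k}
    (h : Consec a σ C u j) (huv : xc σ (a u) < xc σ (a v)) (hvj : xc σ (a v) < xc σ (a j))
    (ho : orient (a u) (a v) (a j) < 0) :
    under a σ r s (insert v C) = under a σ r s C ∪ hull a {j, u, v} := by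
  apply Set.Subset.antisymm
  · intro z hz
    by_cases hc : (xc σ (a u) ≤ xc σ z ∧ xc σ z ≤ xc σ (a j)) ∧ 0 < orient (a u) (a j) z
    · right
      obtain ⟨⟨hc1, hc2⟩, hc3⟩ := hc
      have e := orient_slope σ (a v) (a j) z (a u)
      have e1 : orient (a v) (a j) (a u) = orient (a u) (a v) (a j) := (orient_rot _ _ _).symm
      have e2 : orient (a v) z (a u) = orient (a u) (a v) z := (orient_rot _ _ _).symm
      rw [e1, e2] at e
      rw [hull_triple]
      have h3 : orient (a j) (a u) z ≤ 0 := by rw [orient_swap]; linarith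
      rcases le_total (xc σ z) (xc σ (a v)) with h1 | h1
      · have h2 := hz.2.2.2 u v ((M.consec_insert h huv hvj _ _).2 (Or.inr (Or.inl ⟨rfl, rfl⟩))) hc1 h1
        refine mem_convexHull_triple ho h2 ?_ h3
        by_contra! hn
        nlinarith
      · have h2 := hz.2.2.2 v j ((M.consec_insert h huv hvj _ _).2 (Or.inr (Or.inr ⟨rfl, rfl⟩))) h1 hc2
        refine mem_convexHull_triple ho ?_ h2 h3
        by_contra! hn
        nlinarith
    · left
      refine ⟨hz.1, hz.2.1, hz.2.2.1, fun i m him h1 h2 => ?_⟩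
      rcases M.consec_cases h him with ⟨rfl, rfl⟩ | h3
      · by_contra! hn
        exact hc ⟨⟨h1, h2⟩, hn⟩
      · exact hz.2.2.2 i m ((M.consec_insert h huv hvj _ _).2 (Or.inl ⟨him, h3⟩)) h1 h2
  · rintro z (hz | hz)
    · refine ⟨hz.1, hz.2.1, hz.2.2.1, fun i m him h1 h2 => ?_⟩
      rcases (M.consec_insert h huv hvj _ _).1 him with ⟨him, -⟩ | ⟨rfl, rfl⟩ | ⟨rfl, rfl⟩
      · exact hz.2.2.2 i m him h1 h2
      · have h3 := hz.2.2.2 i j h h1 (by linarith)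
        have e := orient_slope σ (a i) (a m) z (a j)
        rw [orient_swap' (a i) z (a j)] at e
        by_contra! hn
        nlinarith
      · have h3 := hz.2.2.2 u m h (by linarith) h2
        have e := orient_slope σ (a m) (a u) z (a i)
        rw [← orient_rot (a i) (a m) z, orient_swap (a m) (a u) z,
          orient_rot (a m) (a u) (a i)] at e
        by_contra! hn
        nlinarith
    · obtain ⟨h1, h2, h3, h4, h5⟩ := mem_hull_triple huv hvj ho hz
      refine ⟨(M.left u).trans h4, h5.trans (M.right j), ?_, fun i m him hiz hzm => ?_⟩
      · rw [hull_triple] at hz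
        refine convexHull_min ?_ (convex_orient_nonneg (a r) (a s)) hz
        rintro y (rfl | rfl | rfl) <;> exact M.base_nonneg _
      · rcases (M.consec_insert h huv hvj _ _).1 him with ⟨him, h6⟩ | ⟨rfl, rfl⟩ | ⟨rfl, rfl⟩
        · have h7 := him.2.2.1
          have h8 := h.2.2.1
          rw [orient_xy M.sq] at h1 h2 h3 ⊢
          rcases h6 with h6 | h6
          · have e : m = u := M.inj _ _ (by linarith)
            have e' : xc σ z = xc σ (a u) := le_antisymm (by linarith) h4
            subst e
            rw [e'] at h1 h3 ⊢
            nlinarith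
          · have e : i = j := M.inj _ _ (by linarith)
            have e' : xc σ z = xc σ (a j) := le_antisymm h5 (by linarith)
            subst e
            rw [e'] at h2 h3 ⊢
            nlinarith
        · exact h1
        · exact h2

/-- The triangle over an edge of the chain meets the region below the chain in that edge only. -/
theorem Upright.under_inter_hull (M : Upright a σ r s) {C : Set (Fin k)} {u v j : Fin k}
    (h : Consec a σ C u j) (huv : xc σ (a u) < xc σ (a v)) (hvj : xc σ (a v) < xc σ (a j))
    (ho : orient (a u) (a v) (a j) < 0) {z : Plane} (hz : z ∈ under a σ r s C)
    (hz' : z ∈ hull a {j, u, v}) : z ∈ segment ℝ (a u) (a j) := by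
  obtain ⟨-, -, h3, h4, h5⟩ := mem_hull_triple huv hvj ho hz'
  exact mem_segment_of_orient M.sq h.2.2.1 (le_antisymm (hz.2.2.2 u j h h4 h5) h3) h4 h5

/-! ### Growing a triangulation -/

/-- The triangles in `T` triangulate the region between the base and the chain `C` (which is the
base itself as long as `T` is empty). -/
structure Triangulates (a : Fin k → Plane) (σ : ℝ) (r s : Fin k) (C : Set (Fin k))
    (T : List (Finset (Fin k))) : Prop where
  card_eq : ∀ t ∈ T, t.card = 3
  subset : ∀ t ∈ T, ∀ i ∈ t, i ∈ C
  vertex : ∀ t ∈ T, ∀ i ∈ C, a i ∈ hull a t → i ∈ t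
  cover : ∀ z, z ∈ under a σ r s C ↔ z ∈ segment ℝ (a r) (a s) ∨ ∃ t ∈ T, z ∈ hull a t
  base : (∀ i ∈ C, i = r ∨ i = s) ∨ ∃ t ∈ T, r ∈ t ∧ s ∈ t
  inter : ∀ t ∈ T, ∀ t' ∈ T, t ≠ t' → hull a t ∩ hull a t' = hull a (t ∩ t')
  nodup : T.Nodup
  card_chain : C.ncard = T.length + 2

theorem hull_mono {t t' : Finset (Fin k)} (h : t ⊆ t') : hull a t ⊆ hull a t' :=
  convexHull_mono (Set.image_mono (by exact_mod_cast h))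

theorem vertex_mem_hull {t : Finset (Fin k)} {i : Fin k} (h : i ∈ t) : a i ∈ hull a t :=
  subset_convexHull _ _ ⟨i, h, rfl⟩

theorem segment_subset_hull {t : Finset (Fin k)} {i j : Fin k} (hi : i ∈ t) (hj : j ∈ t) :
    segment ℝ (a i) (a j) ⊆ hull a t :=
  (convex_convexHull _ _).segment_subset (vertex_mem_hull hi) (vertex_mem_hull hj)

/-- A triangle inside the region touches an edge of the chain only in common vertices or along the
whole edge: inside the edge, the line through it supports the triangle. -/
theorem Upright.hull_inter_segment (M : Upright a σ r s) {C : Set (Fin k)} {t : Finset (Fin k)}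
    (ht : hull a t ⊆ under a σ r s C) (hv : ∀ i ∈ C, a i ∈ hull a t → i ∈ t)
    {u j : Fin k} (h : Consec a σ C u j) {z : Plane} (hz : z ∈ hull a t)
    (hzs : z ∈ segment ℝ (a u) (a j)) : z ∈ hull a (t ∩ {j, u}) := by
  obtain ⟨h1, h2⟩ := xc_mem_segment hzs h.2.2.1.le
  have h0 := orient_of_mem_segment hzs
  have h0' := h0
  rw [orient_xy M.sq] at h0'
  have huj := h.2.2.1
  rcases eq_or_lt_of_le h1 with e1 | h1
  · have : z = a u := plane_ext_xy M.sq e1.symm (by rw [← e1] at h0'; nlinarith)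
    subst this
    exact vertex_mem_hull (by simp [hv u h.1 hz])
  rcases eq_or_lt_of_le h2 with e2 | h2
  · have : z = a j := plane_ext_xy M.sq e2 (by rw [e2] at h0'; nlinarith)
    subst this
    exact vertex_mem_hull (by simp [hv j h.2.1 hz])
  have hle : ∀ i ∈ t, orient (a u) (a j) (a i) ≤ 0 := by
    intro i hi
    -- a point close to `z` on the way to the vertex `a i` still lies below the edge
    set δ := min (xc σ z - xc σ (a u)) (xc σ (a j) - xc σ z) with hδ
    have hδ0 : 0 < δ := lt_min (by linarith) (by linarith)
    have d1 : δ ≤ xc σ z - xc σ (a u) := min_le_left _ _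
    have d2 : δ ≤ xc σ (a j) - xc σ z := min_le_right _ _
    set b := |xc σ (a i) - xc σ z| with hb
    have hb0 : 0 ≤ b := abs_nonneg _
    set ε := δ / (δ + b) with hε
    have hε0 : 0 < ε := by positivity
    have hε1 : ε ≤ 1 := by rw [hε, div_le_one (by positivity)]; linarith
    have hεb : ε * b ≤ δ := by
      rw [hε, div_mul_eq_mul_div, div_le_iff₀ (by positivity)]
      nlinarith [sq_nonneg δ]
    have hmem : z + ε • (a i - z) ∈ hull a t :=
      (convex_convexHull _ _).segment_subset hz (vertex_mem_hull hi)
        (mem_segment_line.2 ⟨ε, hε0.le, hε1, rfl⟩)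
    have habs : |ε * (xc σ (a i) - xc σ z)| ≤ δ := by
      rw [abs_mul, abs_of_pos hε0]; exact hεb
    obtain ⟨l1, l2⟩ := abs_le.1 habs
    have := (ht hmem).2.2.2 u j h (by rw [xc_line]; linarith) (by rw [xc_line]; linarith)
    rw [orient_line, h0] at this
    by_contra! hn
    nlinarith
  have := mem_convexHull_of_orient_eq_zero (A := a '' (t : Set (Fin k))) hz
    (by rintro _ ⟨i, hi, rfl⟩; exact hle i hi) h0
  refine convexHull_mono ?_ this
  rintro _ ⟨⟨i, hi, rfl⟩, ho⟩
  refine ⟨i, ?_, rfl⟩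
  have hi' : i = j ∨ i = u := by
    by_contra! hc
    exact M.gp u j i (ne_of_xc_lt huj) hc.2.symm hc.1.symm ho
  have hit : i ∈ t := hi
  simp [hit, hi']

theorem Upright.triangulates_base (M : Upright a σ r s) {C : Set (Fin k)}
    (hC : ∀ i, i ∈ C ↔ i = r ∨ i = s) : Triangulates a σ r s C [] := by
  have hc : C = {r, s} := by ext i; simp [hC]
  have hcons : Consec a σ C r s :=
    ⟨(hC r).2 (Or.inl rfl), (hC s).2 (Or.inr rfl), M.lt_rs, fun m hm => by
      rcases (hC m).1 hm with rfl | rfl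
      · left; rfl
      · right; rfl⟩
  refine ⟨by simp, by simp, by simp, fun z => ?_, Or.inl fun i => (hC i).1, by simp, by simp, ?_⟩
  · simp only [List.not_mem_nil, false_and, exists_false, or_false]
    constructor
    · intro hz
      exact mem_segment_of_orient M.sq M.lt_rs
        (le_antisymm (hz.2.2.2 r s hcons hz.1 hz.2.1) hz.2.2.1) hz.1 hz.2.1
    · intro hz
      obtain ⟨h1, h2⟩ := xc_mem_segment hz M.lt_rs.le
      have h0 := orient_of_mem_segment hz
      refine ⟨h1, h2, h0.ge, fun i j hij _ _ => ?_⟩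
      rcases M.consec_cases hcons hij with ⟨rfl, rfl⟩ | h3 | h3
      · exact h0.le
      · exact absurd (hij.2.2.1.trans_le h3) (not_lt.2 (M.left i))
      · exact absurd (h3.trans_lt hij.2.2.1) (not_lt.2 (M.right j))
  · rw [hc, Set.ncard_pair M.ne]; rfl

theorem Upright.triangulates_insert (M : Upright a σ r s) {C : Set (Fin k)}
    {T : List (Finset (Fin k))} (hT : Triangulates a σ r s C T)
    {u v j : Fin k} (h : Consec a σ C u j) (huv : xc σ (a u) < xc σ (a v))
    (hvj : xc σ (a v) < xc σ (a j)) (ho : orient (a u) (a v) (a j) < 0) :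
    Triangulates a σ r s (insert v C) (T ++ [{j, u, v}]) := by
  have hvC : v ∉ C := fun hv => by
    rcases h.2.2.2 v hv with h1 | h1 <;> linarith
  have hsub : ∀ t ∈ T, hull a t ⊆ under a σ r s C := fun t ht z hz =>
    (hT.cover z).2 (Or.inr ⟨t, ht, hz⟩)
  have hvS : a v ∉ under a σ r s C := fun hv => by
    have := hv.2.2.2 u j h huv.le hvj.le
    rw [orient_swap'] at this; linarith
  have hnew : ∀ t ∈ T, hull a t ∩ hull a {j, u, v} = hull a (t ∩ {j, u, v}) := by
    intro t ht
    apply Set.Subset.antisymm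
    · rintro z ⟨hz, hz'⟩
      refine hull_mono ?_ (M.hull_inter_segment (hsub t ht) (hT.vertex t ht) h hz
        (M.under_inter_hull h huv hvj ho (hsub t ht hz) hz'))
      intro i; simp; tauto
    · exact Set.subset_inter (hull_mono Finset.inter_subset_left) (hull_mono Finset.inter_subset_right)
  have hnot : ({j, u, v} : Finset (Fin k)) ∉ T := fun hm => hvC (hT.subset _ hm v (by simp))
  refine ⟨?_, ?_, ?_, ?_, ?_, ?_, ?_, ?_⟩
  · intro t ht
    rcases List.mem_append.1 ht with ht | ht
    · exact hT.card_eq t ht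
    · rw [List.mem_singleton.1 ht]
      exact Finset.card_eq_three.2 ⟨j, u, v, (ne_of_xc_lt h.2.2.1).symm, (ne_of_xc_lt hvj).symm,
        ne_of_xc_lt huv, rfl⟩
  · intro t ht i hi
    rcases List.mem_append.1 ht with ht | ht
    · exact Or.inr (hT.subset t ht i hi)
    · rw [List.mem_singleton.1 ht] at hi
      simp only [Finset.mem_insert, Finset.mem_singleton] at hi
      rcases hi with rfl | rfl | rfl
      · exact Or.inr h.2.1
      · exact Or.inr h.1
      · exact Or.inl rfl
  · intro t ht i hi hz
    rcases List.mem_append.1 ht with ht' | ht'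
    · rcases hi with rfl | hi
      · exact absurd (hsub t ht' hz) hvS
      · exact hT.vertex t ht' i hi hz
    · rw [List.mem_singleton.1 ht'] at hz ⊢
      obtain ⟨-, -, -, h4, h5⟩ := mem_hull_triple huv hvj ho hz
      rcases hi with rfl | hi
      · simp
      · rcases h.2.2.2 i hi with h6 | h6
        · simp [M.inj i u (le_antisymm h6 h4)]
        · simp [M.inj i j (le_antisymm h5 h6)]
  · intro z
    rw [M.under_insert h huv hvj ho, Set.mem_union, hT.cover]
    constructor
    · rintro ((h1 | ⟨t, ht, hz⟩) | hz)
      · exact Or.inl h1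
      · exact Or.inr ⟨t, by simp [ht], hz⟩
      · exact Or.inr ⟨_, by simp, hz⟩
    · rintro (h1 | ⟨t, ht, hz⟩)
      · exact Or.inl (Or.inl h1)
      · rcases List.mem_append.1 ht with ht | ht
        · exact Or.inl (Or.inr ⟨t, ht, hz⟩)
        · rw [List.mem_singleton.1 ht] at hz
          exact Or.inr hz
  · right
    rcases hT.base with hb | ⟨t, ht, h1⟩
    · refine ⟨_, List.mem_append_right _ (List.mem_singleton.2 rfl), ?_⟩
      have hu : u = r := (hb u h.1).resolve_right fun e =>
        absurd h.2.2.1 (not_lt.2 (by rw [e]; exact M.right j))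
      have hj : j = s := (hb j h.2.1).resolve_left fun e =>
        absurd h.2.2.1 (not_lt.2 (by rw [e]; exact M.left u))
      simp [hu, hj]
    · exact ⟨t, by simp [ht], h1⟩
  · intro t ht t' ht' hne
    rcases List.mem_append.1 ht with ht | ht <;> rcases List.mem_append.1 ht' with ht' | ht'
    · exact hT.inter t ht t' ht' hne
    · rw [List.mem_singleton.1 ht']; exact hnew t ht
    · rw [List.mem_singleton.1 ht, Set.inter_comm, Finset.inter_comm]; exact hnew t' ht'
    · exact absurd ((List.mem_singleton.1 ht).trans (List.mem_singleton.1 ht').symm) hne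
  · rw [List.nodup_append]
    refine ⟨hT.nodup, by simp, ?_⟩
    rintro t ht t' ht' rfl
    rw [List.mem_singleton.1 ht'] at ht
    exact hnot ht
  · rw [Set.ncard_insert_of_notMem hvC (Set.toFinite _), hT.card_chain]
    simp

/-- Three different vertices of a polygon in general position form a nondegenerate triangle. -/
theorem Upright.affineIndependent (M : Upright a σ r s) {t : Finset (Fin k)} (ht : t.card = 3) :
    AffineIndependent ℝ fun i : t => a i := by
  obtain ⟨i, j, l, hij, hil, hjl, rfl⟩ := Finset.card_eq_three.1 ht
  have h := (affineIndependent_iff_not_collinear_set (k := ℝ)).2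
    (fun hc => M.gp i j l hij hil hjl (orient_eq_zero_of_collinear hc))
  let e : ({i, j, l} : Finset (Fin k)) → Fin 3 := fun x => if x.1 = i then 0 else if x.1 = j then 1 else 2
  have hx : ∀ x : ({i, j, l} : Finset (Fin k)), x.1 = i ∨ x.1 = j ∨ x.1 = l := fun x => by
    have := x.2
    simpa only [Finset.mem_insert, Finset.mem_singleton] using this
  have he : Function.Injective e := by
    intro x y hxy
    apply Subtype.ext
    rcases hx x with h1 | h1 | h1 <;> rcases hx y with h2 | h2 | h2 <;>
      simp [e, h1, h2, hij.symm, hil.symm, hjl.symm] at hxy ⊢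
  have hcomp : (fun x : ({i, j, l} : Finset (Fin k)) => a x) = ![a i, a j, a l] ∘ e := by
    funext x
    rcases hx x with h1 | h1 | h1 <;>
      simp [e, h1, hij.symm, hil.symm, hjl.symm]
  rw [hcomp]
  exact h.comp_embedding ⟨e, he⟩

theorem Upright.isTriangulation (M : Upright a σ r s) {C : Set (Fin k)}
    {T : List (Finset (Fin k))} (hT : Triangulates a σ r s C T) (hC : under a σ r s C = region a)
    (hb : ∃ i ∈ C, i ≠ r ∧ i ≠ s) : IsTriangulation a {t | t ∈ T} := by
  refine ⟨hT.card_eq, fun t ht => M.affineIndependent (hT.card_eq t ht), ?_, hT.inter⟩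
  rw [← hC]
  ext z
  simp only [Set.mem_iUnion]
  constructor
  · rintro ⟨t, ht, hz⟩
    exact (hT.cover z).2 (Or.inr ⟨t, ht, hz⟩)
  · intro hz
    rcases (hT.cover z).1 hz with h1 | ⟨t, ht, hz⟩
    · rcases hT.base with h2 | ⟨t, ht, h3, h4⟩
      · obtain ⟨i, hi, h5, h6⟩ := hb
        rcases h2 i hi with h | h <;> contradiction
      · exact ⟨t, ht, segment_subset_hull h3 h4 h1⟩
    · exact ⟨t, ht, hz⟩

/-! ### The region of a mountain -/

theorem mem_segment_vertical (h : σ * σ = 1) {p q z : Plane} (hp : xc σ p = xc σ z)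
    (hq : xc σ q = xc σ z) (h1 : yc σ p ≤ yc σ z) (h2 : yc σ z ≤ yc σ q) : z ∈ segment ℝ p q := by
  have h0 : σ ≠ 0 := by rintro rfl; simp at h
  rcases eq_or_lt_of_le (h1.trans h2) with e | e
  · have : z = p := plane_ext_xy h hp.symm (by linarith)
    rw [this]; exact left_mem_segment _ _ _
  · refine mem_segment_line.2 ⟨(yc σ z - yc σ p) / (yc σ q - yc σ p),
      div_nonneg (by linarith) (by linarith), ?_, plane_ext_xy h ?_ ?_⟩
    · rw [div_le_one (by linarith)]; linarith
    · rw [xc_line, hp, hq]; ring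
    · have hne : yc σ q - yc σ p ≠ 0 := by linarith
      have : ∀ t : ℝ, yc σ (p + t • (q - p)) = yc σ p + t * (yc σ q - yc σ p) := by
        intro t; unfold yc; simp; ring
      rw [this, div_mul_cancel₀ _ hne]; ring

/-- A point above the base is in the region as soon as it lies below one edge of the chain in whose
`x`-range it is: edges that share a vertex agree on the vertical line through it. -/
theorem Upright.mem_under_of_consec (M : Upright a σ r s) {C : Set (Fin k)} {i j : Fin k}
    (h : Consec a σ C i j) {z : Plane} (hiz : xc σ (a i) ≤ xc σ z) (hzj : xc σ z ≤ xc σ (a j))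
    (ho : orient (a i) (a j) z ≤ 0) (hb : 0 ≤ orient (a r) (a s) z) : z ∈ under a σ r s C := by
  refine ⟨(M.left i).trans hiz, hzj.trans (M.right j), hb, fun u v huv h1 h2 => ?_⟩
  have h3 := h.2.2.1
  have h4 := huv.2.2.1
  rw [orient_xy M.sq] at ho ⊢
  rcases M.consec_cases h huv with ⟨rfl, rfl⟩ | h5 | h5
  · exact ho
  · have e : v = i := M.inj _ _ (by linarith)
    subst e
    have e : xc σ z = xc σ (a v) := by linarith
    rw [e] at ho ⊢
    nlinarith
  · have e : u = j := M.inj _ _ (by linarith)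
    subst e
    have e : xc σ z = xc σ (a u) := by linarith
    rw [e] at ho ⊢
    nlinarith

/-- The interior of the region below the chain through all vertices. -/
def underInterior {k : ℕ} (a : Fin k → Plane) (σ : ℝ) (r s : Fin k) : Set Plane :=
  {z | xc σ (a r) < xc σ z ∧ xc σ z < xc σ (a s) ∧ 0 < orient (a r) (a s) z ∧
    ∀ i j, Consec a σ Set.univ i j → xc σ (a i) ≤ xc σ z → xc σ z ≤ xc σ (a j) →
      orient (a i) (a j) z < 0}

theorem isOpen_underInterior : IsOpen (underInterior a σ r s) := by
  rw [← isClosed_compl_iff]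
  have e : (underInterior a σ r s)ᶜ = {z | xc σ z ≤ xc σ (a r)} ∪ {z | xc σ (a s) ≤ xc σ z} ∪
      {z | orient (a r) (a s) z ≤ 0} ∪ ⋃ i, ⋃ j, {z | Consec a σ Set.univ i j ∧
        xc σ (a i) ≤ xc σ z ∧ xc σ z ≤ xc σ (a j) ∧ 0 ≤ orient (a i) (a j) z} := by
    ext z
    simp only [underInterior, Set.mem_compl_iff, Set.mem_ofPred_eq, Set.mem_union, Set.mem_iUnion,
      not_and_or, not_lt, not_forall, exists_prop]
    tauto
  rw [e]
  have hx := continuous_xc σ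
  refine ((((isClosed_le hx continuous_const).union (isClosed_le continuous_const hx)).union
    (isClosed_le (continuous_orient _ _) continuous_const)).union ?_)
  refine isClosed_iUnion_of_finite fun i => isClosed_iUnion_of_finite fun j => ?_
  exact isClosed_const.and ((isClosed_le continuous_const hx).and
    ((isClosed_le hx continuous_const).and (isClosed_le continuous_const (continuous_orient _ _))))

theorem Upright.isClosed_under (M : Upright a σ r s) : IsClosed (under a σ r s Set.univ) := by
  have e : under a σ r s Set.univ = ⋃ i, ⋃ j, {z | Consec a σ Set.univ i j ∧
        xc σ (a i) ≤ xc σ z ∧ xc σ z ≤ xc σ (a j) ∧ orient (a i) (a j) z ≤ 0 ∧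
        0 ≤ orient (a r) (a s) z} := by
    ext z
    simp only [Set.mem_iUnion]
    constructor
    · intro hz
      obtain ⟨i, j, h, h1, h2⟩ := M.exists_consec (Set.mem_univ r) (Set.mem_univ s) hz.1 hz.2.1
      exact ⟨i, j, h, h1, h2, hz.2.2.2 i j h h1 h2, hz.2.2.1⟩
    · rintro ⟨i, j, h, h1, h2, h3, h4⟩
      exact M.mem_under_of_consec h h1 h2 h3 h4
  rw [e]
  have hx := continuous_xc σ
  refine isClosed_iUnion_of_finite fun i => isClosed_iUnion_of_finite fun j => ?_
  exact isClosed_const.and ((isClosed_le continuous_const hx).and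
    ((isClosed_le hx continuous_const).and ((isClosed_le (continuous_orient _ _) continuous_const).and
    (isClosed_le continuous_const (continuous_orient _ _)))))

theorem Upright.isBounded_under (M : Upright a σ r s) :
    Bornology.IsBounded (under a σ r s Set.univ) := by
  refine Bornology.IsBounded.subset (isBounded_convexHull.2 (Set.finite_range a).isBounded) ?_
  intro z hz
  obtain ⟨i, j, h, h1, h2⟩ := M.exists_consec (Set.mem_univ r) (Set.mem_univ s) hz.1 hz.2.1
  have key : ∀ u v, xc σ (a u) < xc σ (a v) → xc σ (a u) ≤ xc σ z → xc σ z ≤ xc σ (a v) →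
      ∃ p ∈ convexHull ℝ (Set.range a), xc σ p = xc σ z ∧ orient (a u) (a v) p = 0 := by
    intro u v h3 h4 h5
    refine ⟨a u + ((xc σ z - xc σ (a u)) / (xc σ (a v) - xc σ (a u))) • (a v - a u), ?_, ?_, ?_⟩
    · refine (convex_convexHull ℝ _).segment_subset (subset_convexHull _ _ (Set.mem_range_self u))
        (subset_convexHull _ _ (Set.mem_range_self v)) (mem_segment_line.2 ⟨_, ?_, ?_, rfl⟩)
      · exact div_nonneg (by linarith) (by linarith)
      · rw [div_le_one (by linarith)]; linarith
    · rw [xc_line, div_mul_cancel₀ _ (by linarith)]; ring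
    · rw [orient_line]; simp
  obtain ⟨p, hp, hpx, hpo⟩ := key r s M.lt_rs hz.1 hz.2.1
  obtain ⟨q, hq, hqx, hqo⟩ := key i j h.2.2.1 h1 h2
  have h3 := hz.2.2.1
  have h4 := hz.2.2.2 i j h h1 h2
  have h5 := M.lt_rs
  have h6 := h.2.2.1
  rw [orient_xy M.sq] at h3 h4 hpo hqo
  rw [hpx] at hpo
  rw [hqx] at hqo
  exact (convex_convexHull ℝ _).segment_subset hp hq
    (mem_segment_vertical M.sq hpx hqx (by nlinarith) (by nlinarith))

/-- The base and the edges of the chain. -/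
def outline {k : ℕ} (a : Fin k → Plane) (σ : ℝ) (r s : Fin k) : Set Plane :=
  {z | z ∈ segment ℝ (a r) (a s) ∨ ∃ i j, Consec a σ Set.univ i j ∧ z ∈ segment ℝ (a i) (a j)}

theorem Upright.outline_subset_under (M : Upright a σ r s)  :
    outline a σ r s ⊆ under a σ r s Set.univ := by
  rintro z (hz | ⟨i, j, h, hz⟩)
  · have h0 := orient_of_mem_segment hz
    obtain ⟨h1, h2⟩ := xc_mem_segment hz M.lt_rs.le
    obtain ⟨i, j, h, h3, h4⟩ := M.exists_consec (Set.mem_univ r) (Set.mem_univ s) h1 h2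
    refine M.mem_under_of_consec h h3 h4 ?_ h0.ge
    have hi := M.base_nonneg i
    have hj := M.base_nonneg j
    have h5 := M.lt_rs
    have h6 := h.2.2.1
    rw [orient_xy M.sq] at *
    set x1 := xc σ (a i); set x2 := xc σ (a j); set y1 := yc σ (a i); set y2 := yc σ (a j)
    set px := xc σ (a r); set py := yc σ (a r); set qx := xc σ (a s); set qy := yc σ (a s)
    have e : (qx - px) * ((x2 - x1) * (yc σ z - y1) - (y2 - y1) * (xc σ z - x1)) =
      - ((x2 - xc σ z) * ((qx - px) * (y1 - py) - (qy - py) * (x1 - px)) +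
        (xc σ z - x1) * ((qx - px) * (y2 - py) - (qy - py) * (x2 - px))) := by
      linear_combination (x2 - x1) * h0
    have := mul_nonneg (sub_nonneg.2 h4) hi
    have := mul_nonneg (sub_nonneg.2 h3) hj
    by_contra! hc
    have := mul_pos (sub_pos.2 h5) hc
    linarith
  · obtain ⟨h1, h2⟩ := xc_mem_segment hz h.2.2.1.le
    exact M.mem_under_of_consec h h1 h2 (orient_of_mem_segment hz).le
      (orient_nonneg_segment hz (M.base_nonneg i) (M.base_nonneg j))

theorem Upright.mem_underInterior (M : Upright a σ r s) {z : Plane}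
    (hz : z ∈ under a σ r s Set.univ) (ho : z ∉ outline a σ r s) : z ∈ underInterior a σ r s := by
  obtain ⟨i, j, h, h1, h2⟩ := M.exists_consec (Set.mem_univ r) (Set.mem_univ s) hz.1 hz.2.1
  have h3 := hz.2.2.1
  have h4 := hz.2.2.2 i j h h1 h2
  have h5 := M.lt_rs
  have h6 := h.2.2.1
  refine ⟨?_, ?_, ?_, ?_⟩
  · refine lt_of_le_of_ne hz.1 fun e => ho (Or.inl ?_)
    have e' : i = r := M.inj _ _ (le_antisymm (by linarith) (M.left i))
    subst e'
    rw [orient_xy M.sq, ← e] at h3 h4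
    have : z = a i := plane_ext_xy M.sq e.symm (le_antisymm (by nlinarith) (by nlinarith))
    rw [this]; exact left_mem_segment _ _ _
  · refine lt_of_le_of_ne hz.2.1 fun e => ho (Or.inl ?_)
    have e' : j = s := M.inj _ _ (le_antisymm (M.right j) (by linarith))
    subst e'
    rw [orient_xy M.sq, e] at h3 h4
    have : z = a j := plane_ext_xy M.sq e (le_antisymm (by nlinarith) (by nlinarith))
    rw [this]; exact right_mem_segment _ _ _
  · exact lt_of_le_of_ne h3 fun e => ho (Or.inl (mem_segment_of_orient M.sq h5 e.symm hz.1 hz.2.1))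
  · intro u v huv h7 h8
    exact lt_of_le_of_ne (hz.2.2.2 u v huv h7 h8) fun e =>
      ho (Or.inr ⟨u, v, huv, mem_segment_of_orient M.sq huv.2.2.1 e h7 h8⟩)

theorem not_isBounded_of_ray {B : Set Plane} {z v : Plane} (hv : v ≠ 0)
    (h : ∀ t : ℝ, 0 ≤ t → z + t • v ∈ B) : ¬ Bornology.IsBounded B := by
  intro hb
  obtain ⟨R, hR⟩ := hb.exists_norm_le
  have hv' : 0 < ‖v‖ := norm_pos_iff.2 hv
  have hz := hR _ (h 0 le_rfl)
  have hR0 : 0 ≤ R := (norm_nonneg _).trans hz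
  have h1 := hR _ (h ((R + ‖z‖ + 1) / ‖v‖) (by positivity))
  have h2 : ‖((R + ‖z‖ + 1) / ‖v‖) • v‖ = R + ‖z‖ + 1 := by
    rw [norm_smul, Real.norm_of_nonneg (by positivity), div_mul_cancel₀ _ hv'.ne']
  have h3 := norm_sub_norm_le (((R + ‖z‖ + 1) / ‖v‖) • v) (-z)
  rw [norm_neg, h2, sub_neg_eq_add, add_comm _ z] at h3
  linarith

/-- From a point outside, a vertical ray leads to infinity without meeting the region. -/
theorem Upright.exists_ray (M : Upright a σ r s) {z : Plane} (hz : z ∉ under a σ r s Set.univ) :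
    ∃ v : Plane, v ≠ 0 ∧ ∀ t : ℝ, 0 ≤ t → z + t • v ∉ under a σ r s Set.univ := by
  have hσ : σ ≠ 0 := by rintro rfl; simpa using M.sq
  have hx : ∀ c t : ℝ, xc σ (z + t • !₂[0, c]) = xc σ z := by
    intro c t; unfold xc; simp
  have ho : ∀ (c t : ℝ) (p q : Plane), orient p q (z + t • !₂[0, c * σ]) =
      orient p q z + t * c * (xc σ q - xc σ p) := by
    intro c t p q; unfold xc orient; simp; ring
  have hne : ∀ c : ℝ, c ≠ 0 → (!₂[0, c * σ] : Plane) ≠ 0 := by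
    intro c hc h
    have : (!₂[0, c * σ] : Plane) 1 = 0 := by rw [h]; rfl
    simp [hc, hσ] at this
  by_cases h1 : xc σ (a r) ≤ xc σ z ∧ xc σ z ≤ xc σ (a s)
  · by_cases h2 : 0 ≤ orient (a r) (a s) z
    · obtain ⟨i, j, h, h3, h4⟩ := M.exists_consec (Set.mem_univ r) (Set.mem_univ s) h1.1 h1.2
      refine ⟨!₂[0, 1 * σ], hne 1 one_ne_zero, fun t ht hm => hz ?_⟩
      have := hm.2.2.2 i j h (by rwa [hx]) (by rwa [hx])
      rw [ho] at this
      have h5 := h.2.2.1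
      exact M.mem_under_of_consec h h3 h4 (by nlinarith) h2
    · refine ⟨!₂[0, -1 * σ], hne _ (by simp), fun t ht hm => h2 ?_⟩
      have := hm.2.2.1
      rw [ho] at this
      nlinarith [M.lt_rs]
  · refine ⟨!₂[0, 1 * σ], hne 1 one_ne_zero, fun t ht hm => h1 ?_⟩
    have e1 := hm.1
    have e2 := hm.2.1
    rw [hx] at e1 e2
    exact ⟨e1, e2⟩

/-- The Jordan curve theorem for a mountain: the region enclosed by it lies between the base and the
chain. -/
theorem Upright.region_eq (M : Upright a σ r s) (hB : boundary a = outline a σ r s) :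
    region a = under a σ r s Set.univ := by
  unfold region
  rw [hB]
  apply Set.Subset.antisymm
  · rintro z (hz | ⟨hz, hb⟩)
    · exact M.outline_subset_under hz
    · by_contra hn
      obtain ⟨v, hv, hray⟩ := M.exists_ray hn
      refine not_isBounded_of_ray (z := z) hv ?_ hb
      have hpre : IsPreconnected ((fun t : ℝ => z + t • v) '' Set.Ici 0) :=
        isPreconnected_Ici.image _ (by fun_prop)
      have := hpre.subset_connectedComponentIn (x := z) (F := (outline a σ r s)ᶜ)
        ⟨0, by simp, by simp⟩ (by
          rintro _ ⟨t, ht, rfl⟩ hm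
          exact hray t ht (M.outline_subset_under hm))
      exact fun t ht => this ⟨t, ht, rfl⟩
  · intro z hz
    by_cases ho : z ∈ outline a σ r s
    · exact Or.inl ho
    · refine Or.inr ⟨ho, M.isBounded_under.subset ?_⟩
      have hsub : connectedComponentIn (outline a σ r s)ᶜ z ⊆ underInterior a σ r s := by
        refine isPreconnected_connectedComponentIn.subset_left_of_subset_union
          isOpen_underInterior M.isClosed_under.isOpen_compl ?_ ?_ ?_
        · rw [Set.disjoint_left]
          intro y hy hy'
          obtain ⟨h1, h2, h3, h4⟩ := hy
          exact hy' ⟨h1.le, h2.le, h3.le, fun i j h h5 h6 => (h4 i j h h5 h6).le⟩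
        · intro y hy
          have hyo := connectedComponentIn_subset _ _ hy
          by_cases hyu : y ∈ under a σ r s Set.univ
          · exact Or.inl (M.mem_underInterior hyu hyo)
          · exact Or.inr hyu
        · exact ⟨z, mem_connectedComponentIn ho, M.mem_underInterior hz ho⟩
      intro y hy
      obtain ⟨h1, h2, h3, h4⟩ := hsub hy
      exact ⟨h1.le, h2.le, h3.le, fun i j h h5 h6 => (h4 i j h h5 h6).le⟩

/-! ### Turning a mountain upright -/

theorem edge_castSucc {n : ℕ} (a : Fin (n + 1) → Plane) (i : Fin n) :
    edge a i.castSucc = segment ℝ (a i.castSucc) (a i.succ) := by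
  unfold edge; rw [finRotate_apply, Fin.coeSucc_eq_succ]

theorem edge_last {n : ℕ} (a : Fin (n + 1) → Plane) :
    edge a (Fin.last n) = segment ℝ (a (Fin.last n)) (a 0) := by
  unfold edge; rw [finRotate_last]

theorem boundary_eq {n : ℕ} (a : Fin (n + 1) → Plane) :
    boundary a = segment ℝ (a 0) (a (Fin.last n)) ∪
      ⋃ i : Fin n, segment ℝ (a i.castSucc) (a i.succ) := by
  unfold boundary
  ext z
  simp only [Set.mem_iUnion, Set.mem_union]
  rw [segment_symm, ← edge_last]
  simp only [← edge_castSucc]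
  constructor
  · rintro ⟨i, hi⟩
    induction i using Fin.lastCases with
    | last => exact Or.inl hi
    | cast i => exact Or.inr ⟨i, hi⟩
  · rintro (h | ⟨i, hi⟩)
    · exact ⟨_, h⟩
    · exact ⟨_, hi⟩

theorem sum_succ_sub_castSucc (n : ℕ) (F : Fin (n + 1) → ℝ) :
    ∑ i : Fin n, (F i.succ - F i.castSucc) = F (Fin.last n) - F 0 := by
  induction n with
  | zero => simp
  | succ n ih =>
    rw [Fin.sum_univ_castSucc]
    have := ih (fun i => F i.castSucc)
    simp only [Fin.succ_castSucc] at *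
    rw [this]
    simp

/-- The trapezoid formula for the area between the chain and the base. -/
theorem signedArea_eq {n : ℕ} (a : Fin (n + 1) → Plane) :
    (a (Fin.last n) 0 - a 0 0) * signedArea a =
      -∑ i : Fin n, (a i.succ 0 - a i.castSucc 0) *
        (orient (a 0) (a (Fin.last n)) (a i.castSucc) + orient (a 0) (a (Fin.last n)) (a i.succ)) := by
  unfold signedArea
  rw [Fin.sum_univ_castSucc]
  simp only [finRotate_apply, Fin.coeSucc_eq_succ, Fin.last_add_one]
  set p := a 0 with hp
  set q := a (Fin.last n) with hq
  have := sum_succ_sub_castSucc n (fun i => (q 0 - p 0) * (a i 0 * a i 1 - 2 * p 1 * a i 0) -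
    (q 1 - p 1) * (a i 0 - p 0) ^ 2)
  have e : ∀ i : Fin n, (q 0 - p 0) * (a i.castSucc 0 * a i.succ 1 - a i.castSucc 1 * a i.succ 0) +
      (a i.succ 0 - a i.castSucc 0) * (orient p q (a i.castSucc) + orient p q (a i.succ)) =
      ((q 0 - p 0) * (a i.succ 0 * a i.succ 1 - 2 * p 1 * a i.succ 0) -
        (q 1 - p 1) * (a i.succ 0 - p 0) ^ 2) -
      ((q 0 - p 0) * (a i.castSucc 0 * a i.castSucc 1 - 2 * p 1 * a i.castSucc 0) -
        (q 1 - p 1) * (a i.castSucc 0 - p 0) ^ 2) := by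
    intro i; unfold orient; ring
  rw [← Finset.sum_congr rfl fun i _ => e i, Finset.sum_add_distrib, ← Finset.mul_sum] at this
  rw [mul_add, eq_neg_iff_add_eq_zero]
  rw [← hp, ← hq] at this
  linear_combination this

theorem orient_ne_zero {k : ℕ} {a : Fin k → Plane} (h : InGeneralPosition a) (i j l : Fin k)
    (hij : i ≠ j) (hil : i ≠ l) (hjl : j ≠ l) : orient (a i) (a j) (a l) ≠ 0 :=
  fun e => h i j l hij hil hjl (collinear_of_orient_eq_zero e)

theorem xc_one (p : Plane) : xc 1 p = p 0 := by unfold xc; ring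

theorem xc_neg_one (p : Plane) : xc (-1) p = -p 0 := by unfold xc; ring

/-- An edge of the chain cannot cross the base. -/
theorem IsMountain.not_cross {n : ℕ} {a : Fin (n + 1) → Plane} (h : IsMountain a) (i : Fin n)
    (hi : i.castSucc ≠ 0) (hi' : i.succ ≠ Fin.last n) {c : ℝ} (hc : c = 1 ∨ c = -1)
    (h1 : 0 < c * orient (a 0) (a (Fin.last n)) (a i.castSucc)) :
    0 ≤ c * orient (a 0) (a (Fin.last n)) (a i.succ) := by
  by_contra! h2
  set p := orient (a 0) (a (Fin.last n)) (a i.castSucc) with hp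
  set q := orient (a 0) (a (Fin.last n)) (a i.succ) with hq
  have hc2 : c * c = 1 := by rcases hc with rfl | rfl <;> norm_num
  have hd : 0 < c * p - c * q := by linarith
  set t := c * p / (c * p - c * q) with ht
  have ht0 : 0 ≤ t := div_nonneg h1.le hd.le
  have ht1 : t ≤ 1 := by rw [ht, div_le_one hd]; linarith
  have htm : t * (c * p - c * q) = c * p := div_mul_cancel₀ _ hd.ne'
  set z := a i.castSucc + t • (a i.succ - a i.castSucc) with hz
  have hz1 : z ∈ edge a i.castSucc := by
    rw [edge_castSucc]; exact mem_segment_line.2 ⟨t, ht0, ht1, rfl⟩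
  have hx : ∀ u v, xc 1 (a u) ≤ xc 1 (a v) ↔ u ≤ v := by
    intro u v; rw [xc_one, xc_one]; exact h.monotone.le_iff_le
  have hx' : ∀ u v, xc 1 (a u) < xc 1 (a v) ↔ u < v := by
    intro u v; rw [xc_one, xc_one]; exact h.monotone.lt_iff_lt
  have hz2 : z ∈ edge a (Fin.last n) := by
    rw [edge_last, segment_symm]
    rw [edge_castSucc] at hz1
    obtain ⟨l1, l2⟩ := xc_mem_segment hz1 ((hx _ _).2 i.castSucc_lt_succ.le)
    refine mem_segment_of_orient (σ := 1) (by norm_num) ?_ ?_ (((hx _ _).2 (Fin.zero_le _)).trans l1)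
      (l2.trans ((hx _ _).2 (Fin.le_last _)))
    · rw [hx']; exact (Fin.pos_of_ne_zero hi).trans_le (Fin.le_last _)
    · rw [hz, orient_line, ← hp, ← hq]
      linear_combination (-t*(p - q) + p) * (-hc2) - c * htm
  have hmem := h.simple.edge_inter i.castSucc (Fin.last n) (Fin.castSucc_lt_last i).ne ⟨hz1, hz2⟩
  rw [finRotate_apply, Fin.coeSucc_eq_succ, finRotate_last] at hmem
  obtain ⟨m1, m2⟩ := hmem
  have inj := h.simple.injective
  rcases m1 with m1 | m1 <;> rcases m2 with m2 | m2
  · exact (Fin.castSucc_lt_last i).ne (inj (m1.symm.trans m2))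
  · exact hi (inj (m1.symm.trans m2))
  · exact hi' (inj (m1.symm.trans m2))
  · exact Fin.succ_ne_zero i (inj (m1.symm.trans m2))

/-- The chain lies on one side of the base. -/
theorem IsMountain.exists_side {n : ℕ} {a : Fin (n + 1) → Plane} (h : IsMountain a)
    (hg : InGeneralPosition a) : ∃ c : ℝ, (c = 1 ∨ c = -1) ∧
      ∀ i, i ≠ 0 → i ≠ Fin.last n → 0 < c * orient (a 0) (a (Fin.last n)) (a i) := by
  have hn : 2 ≤ n := by have := h.simple.three_le; omega
  have hne : ∀ i, i ≠ 0 → i ≠ Fin.last n → orient (a 0) (a (Fin.last n)) (a i) ≠ 0 := by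
    intro i h0 h1
    exact orient_ne_zero hg _ _ _ (by rw [Ne, Fin.ext_iff]; simp; omega) h0.symm h1.symm
  obtain ⟨c, hc, h1⟩ : ∃ c : ℝ, (c = 1 ∨ c = -1) ∧
      0 < c * orient (a 0) (a (Fin.last n)) (a ⟨1, by omega⟩) := by
    rcases lt_or_gt_of_ne (hne ⟨1, by omega⟩ (by rw [Ne, Fin.ext_iff]; simp)
      (by rw [Ne, Fin.ext_iff]; simp; omega)) with h1 | h1
    · exact ⟨-1, Or.inr rfl, by linarith⟩
    · exact ⟨1, Or.inl rfl, by linarith⟩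
  refine ⟨c, hc, ?_⟩
  have key : ∀ m (hm : m + 1 < n), 0 < c * orient (a 0) (a (Fin.last n)) (a ⟨m + 1, by omega⟩) := by
    intro m
    induction m with
    | zero => intro _; exact h1
    | succ m ih =>
      intro hm
      have := h.not_cross ⟨m + 1, by omega⟩ (by rw [Ne, Fin.ext_iff]; simp)
        (by rw [Ne, Fin.ext_iff]; simp; omega) hc (ih (by omega))
      refine lt_of_le_of_ne this (Ne.symm (mul_ne_zero ?_ (hne _ ?_ ?_)))
      · rcases hc with rfl | rfl <;> norm_num
      · rw [Ne, Fin.ext_iff]; simp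
      · rw [Ne, Fin.ext_iff]; simp; omega
  intro i h0 hl
  rw [Ne, Fin.ext_iff] at h0 hl
  obtain ⟨m, hm⟩ := i
  simp at h0 hl
  obtain ⟨m, rfl⟩ := Nat.exists_eq_succ_of_ne_zero h0
  exact key m (by omega)

theorem IsMountain.signedArea_neg {n : ℕ} {a : Fin (n + 1) → Plane} (h : IsMountain a) {c : ℝ}
    (hs : ∀ i, i ≠ 0 → i ≠ Fin.last n → 0 < c * orient (a 0) (a (Fin.last n)) (a i)) :
    c * signedArea a < 0 := by
  have hn : 2 ≤ n := by have := h.simple.three_le; omega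
  have hx : 0 < a (Fin.last n) 0 - a 0 0 :=
    sub_pos.2 (h.monotone (by rw [Fin.lt_def]; simp; omega))
  have e := signedArea_eq a
  have hnn : ∀ i, 0 ≤ c * orient (a 0) (a (Fin.last n)) (a i) := by
    intro i
    by_cases h0 : i = 0
    · simp [h0]
    by_cases h1 : i = Fin.last n
    · simp [h1]
    exact (hs i h0 h1).le
  have hpos : 0 < ∑ i : Fin n, (a i.succ 0 - a i.castSucc 0) *
      (c * orient (a 0) (a (Fin.last n)) (a i.castSucc) +
        c * orient (a 0) (a (Fin.last n)) (a i.succ)) := by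
    refine Finset.sum_pos (fun i _ => mul_pos (sub_pos.2 (h.monotone i.castSucc_lt_succ)) ?_)
      ⟨⟨0, by omega⟩, Finset.mem_univ _⟩
    by_cases h0 : i.castSucc = 0
    · refine add_pos_of_nonneg_of_pos (hnn _) (hs _ (Fin.succ_ne_zero _) ?_)
      rw [Fin.ext_iff] at h0
      rw [Ne, Fin.ext_iff]
      simp at h0 ⊢
      omega
    · exact add_pos_of_pos_of_nonneg (hs _ h0 (Fin.castSucc_lt_last i).ne) (hnn _)
  have e2 : c * ((a (Fin.last n) 0 - a 0 0) * signedArea a) = -∑ i : Fin n,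
      (a i.succ 0 - a i.castSucc 0) * (c * orient (a 0) (a (Fin.last n)) (a i.castSucc) +
        c * orient (a 0) (a (Fin.last n)) (a i.succ)) := by
    rw [e, mul_neg, Finset.mul_sum]
    congr 1
    exact Finset.sum_congr rfl fun i _ => by ring
  by_contra! hc
  have := mul_nonneg hx.le hc
  linarith

theorem consec_iff_succ {n : ℕ} {a : Fin (n + 1) → Plane}
    (hm : StrictMono fun i => xc 1 (a i)) (i j : Fin (n + 1)) :
    Consec a 1 Set.univ i j ↔ i.val + 1 = j.val := by
  have hx : ∀ u v, xc 1 (a u) ≤ xc 1 (a v) ↔ u ≤ v := fun u v => hm.le_iff_le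
  have hx' : ∀ u v, xc 1 (a u) < xc 1 (a v) ↔ u < v := fun u v => hm.lt_iff_lt
  unfold Consec
  simp only [Set.mem_univ, true_and, forall_const, hx, hx']
  constructor
  · rintro ⟨h1, h2⟩
    rw [Fin.lt_def] at h1
    have := h2 ⟨i.val + 1, by omega⟩
    simp only [Fin.le_def] at this
    omega
  · intro h
    simp only [Fin.lt_def, Fin.le_def]
    exact ⟨by omega, fun m => by omega⟩

theorem consec_neg {k : ℕ} {a : Fin k → Plane} {i j : Fin k} :
    Consec a (-1) Set.univ i j ↔ Consec a 1 Set.univ j i := by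
  unfold Consec
  simp only [Set.mem_univ, true_and, forall_const, xc_one, xc_neg_one, neg_lt_neg_iff, neg_le_neg_iff]
  constructor <;> rintro ⟨h1, h2⟩ <;> exact ⟨h1, fun m => (h2 m).symm⟩

theorem outline_one {n : ℕ} {a : Fin (n + 1) → Plane} (hm : StrictMono fun i => xc 1 (a i)) :
    boundary a = outline a 1 0 (Fin.last n) := by
  rw [boundary_eq]
  ext z
  simp only [outline, Set.mem_union, Set.mem_iUnion, Set.mem_ofPred_eq, consec_iff_succ hm]
  refine or_congr_right ⟨?_, ?_⟩
  · rintro ⟨i, hi⟩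
    exact ⟨_, _, by simp, hi⟩
  · rintro ⟨i, j, hij, hz⟩
    have hj : j = (⟨i, by omega⟩ : Fin n).succ := Fin.ext (by simpa using hij.symm)
    rw [hj] at hz
    exact ⟨⟨i, by omega⟩, hz⟩

theorem outline_neg {k : ℕ} {a : Fin k → Plane} {r s : Fin k} :
    outline a (-1) r s = outline a 1 s r := by
  ext z
  simp only [outline, Set.mem_ofPred_eq]
  rw [segment_symm]
  refine or_congr_right ⟨?_, ?_⟩ <;> rintro ⟨i, j, hij, hz⟩ <;>
    exact ⟨j, i, by first | exact consec_neg.1 hij | exact consec_neg.2 hij, by rwa [segment_symm]⟩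

/-- Up to half a turn, a mountain lies above its base; then `root` is the leftmost vertex, and the
counterclockwise order goes from right to left. -/
theorem IsMountain.exists_upright {k : ℕ} [NeZero k] {a : Fin k → Plane} (h : IsMountain a)
    (hg : InGeneralPosition a) : ∃ σ : ℝ, Upright a σ (root a) (scanStart a) ∧
      boundary a = outline a σ (root a) (scanStart a) ∧
      StrictAnti fun i => xc σ (a (ccw a i)) := by
  obtain ⟨n, rfl⟩ : ∃ n, k = n + 1 := ⟨k - 1, by have := h.simple.three_le; omega⟩
  have hn : 2 ≤ n := by have := h.simple.three_le; omega
  obtain ⟨c, hc, hs⟩ := h.exists_side hg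
  have hA := h.signedArea_neg hs
  have hm : StrictMono fun i => xc 1 (a i) := by simp only [xc_one]; exact h.monotone
  have hm' : StrictAnti fun i => xc (-1) (a i) := by
    simp only [xc_neg_one]; exact fun i j hij => neg_lt_neg (h.monotone hij)
  have h0l : (0 : Fin (n + 1)) ≠ Fin.last n := by rw [Ne, Fin.ext_iff]; simp; omega
  rcases hc with rfl | rfl
  · have hccw : ccw a = Fin.rev := by unfold ccw; rw [if_neg (by linarith)]
    have e1 : root a = 0 := by unfold root; rw [hccw, Fin.rev_rev]
    have e2 : scanStart a = Fin.last n := by unfold scanStart; rw [hccw, Fin.rev_zero]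
    rw [e1, e2, hccw]
    refine ⟨1, ⟨by norm_num, fun i j e => hm.injective e, fun i => hm.monotone (Fin.zero_le i),
      fun i => hm.monotone (Fin.le_last i), h0l, fun i h0 h1 => by simpa using hs i h0 h1,
      orient_ne_zero hg⟩, outline_one hm, fun i j hij => hm (Fin.rev_lt_rev.2 hij)⟩
  · have hccw : ccw a = id := by unfold ccw; rw [if_pos (by linarith)]
    have e1 : root a = Fin.last n := by unfold root; rw [hccw, Fin.rev_zero]; rfl
    have e2 : scanStart a = 0 := by unfold scanStart; rw [hccw]; rfl
    rw [e1, e2, hccw]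
    refine ⟨-1, ⟨by norm_num, fun i j e => hm'.injective e, fun i => hm'.antitone (Fin.le_last i),
      fun i => hm'.antitone (Fin.zero_le i), h0l.symm, fun i h1 h0 => ?_,
      orient_ne_zero hg⟩, ?_, hm'⟩
    · have := hs i h0 h1
      rw [orient_swap]; linarith
    · rw [outline_neg]; exact outline_one hm

/-! ### The shortest path tree -/

/-- `u` is the vertex to the left of `v` such that the line from `u` to `v` passes below all other
vertices to the left of `v`; it is the parent of `v` in the shortest path tree. -/
def Par {k : ℕ} (a : Fin k → Plane) (σ : ℝ) (u v : Fin k) : Prop :=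
  xc σ (a u) < xc σ (a v) ∧
    ∀ i, i ≠ u → xc σ (a i) < xc σ (a v) → 0 < orient (a u) (a v) (a i)

theorem Par.unique {u u' v : Fin k} (h : Par a σ u v) (h' : Par a σ u' v) : u = u' := by
  by_contra hne
  have h1 := h.2 u' (Ne.symm hne) h'.1
  have h2 := h'.2 u hne h.1
  unfold orient at h1 h2
  linarith

/-- The parent is the vertex from which the slope to `v` is largest. -/
theorem Upright.exists_par (M : Upright a σ r s) {v : Fin k} (hv : v ≠ r) :
    ∃ u, Par a σ u v := by
  obtain ⟨u, hu, hmax⟩ := Set.exists_max_image {i | xc σ (a i) < xc σ (a v)}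
    (fun i => (yc σ (a v) - yc σ (a i)) / (xc σ (a v) - xc σ (a i))) (Set.toFinite _)
    ⟨r, M.xc_lt (M.left v) (Ne.symm hv)⟩
  replace hu : xc σ (a u) < xc σ (a v) := hu
  refine ⟨u, hu, fun i hiu hiv => lt_of_le_of_ne ?_ (M.gp u v i ?_ (Ne.symm hiu) ?_).symm⟩
  · have := hmax i hiv
    rw [div_le_div_iff₀ (by linarith) (by linarith)] at this
    rw [orient_xy M.sq]
    linarith
  · exact ne_of_xc_lt hu
  · exact (ne_of_xc_lt hiv).symm

theorem induction_left {p : Fin k → Prop}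
    (h : ∀ v, (∀ u, xc σ (a u) < xc σ (a v) → p u) → p v) (v : Fin k) : p v := by
  have wf : WellFounded fun u v : Fin k => xc σ (a u) < xc σ (a v) :=
    @Finite.wellFounded_of_trans_of_irrefl _ _ _ ⟨fun _ _ _ => lt_trans⟩ ⟨fun _ => lt_irrefl _⟩
  exact wf.induction v h

theorem Upright.vertex_mem_under (M : Upright a σ r s) (i : Fin k) :
    a i ∈ under a σ r s Set.univ := by
  obtain ⟨p, q, h, h1, h2⟩ := M.exists_consec (Set.mem_univ r) (Set.mem_univ s) (M.left i) (M.right i)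
  refine M.mem_under_of_consec h h1 h2 ?_ (M.base_nonneg i)
  rcases h.2.2.2 i (Set.mem_univ i) with h3 | h3
  · rw [M.inj i p (le_antisymm h3 h1)]; simp
  · rw [M.inj i q (le_antisymm h2 h3)]; simp

theorem Upright.yc_le_of_mem_under (M : Upright a σ r s) {z : Plane}
    (hz : z ∈ under a σ r s Set.univ) {u : Fin k} (h : xc σ z = xc σ (a u)) :
    yc σ z ≤ yc σ (a u) := by
  obtain ⟨p, q, hpq, h1, h2⟩ := M.exists_consec (Set.mem_univ r) (Set.mem_univ s) hz.1 hz.2.1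
  have h3 := hz.2.2.2 p q hpq h1 h2
  have h4 := hpq.2.2.1
  rw [h] at h1 h2
  rw [orient_xy M.sq, h] at h3
  rcases hpq.2.2.2 u (Set.mem_univ u) with h5 | h5
  · obtain rfl := M.inj u p (le_antisymm h5 h1)
    nlinarith
  · obtain rfl := M.inj u q (le_antisymm h2 h5)
    nlinarith

theorem Upright.segment_subset_region (M : Upright a σ r s)
    (hR : region a = under a σ r s Set.univ) {u v : Fin k} (huv : xc σ (a u) < xc σ (a v))
    (h : ∀ i, xc σ (a u) < xc σ (a i) → xc σ (a i) < xc σ (a v) → 0 < orient (a u) (a v) (a i)) :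
    segment ℝ (a u) (a v) ⊆ region a := by
  rw [hR]
  exact M.segment_subset_under huv (M.vertex_mem_under u) (M.vertex_mem_under v)
    fun i _ h1 h2 => (h i h1 h2).le

theorem Upright.par_segment (M : Upright a σ r s) (hR : region a = under a σ r s Set.univ)
    {u v : Fin k} (h : Par a σ u v) : segment ℝ (a u) (a v) ⊆ region a :=
  M.segment_subset_region hR h.1 fun i h1 h2 => h.2 i (ne_of_xc_lt h1).symm h2

/-! ### Lengths of chains -/

theorem dist_sq_xy (h : σ * σ = 1) (p q : Plane) :
    dist p q ^ 2 = (xc σ q - xc σ p) ^ 2 + (yc σ q - yc σ p) ^ 2 := by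
  rw [EuclideanSpace.dist_eq, Real.sq_sqrt (Finset.sum_nonneg fun _ _ => sq_nonneg _)]
  simp only [Fin.sum_univ_two, Real.dist_eq, sq_abs]
  unfold xc yc
  linear_combination (-(p 0 - q 0) ^ 2 - (p 1 - q 1) ^ 2) * h

theorem le_dist_xy (h : σ * σ = 1) {c e : ℝ} (hce : c ^ 2 + e ^ 2 = 1) (p q : Plane) :
    c * (xc σ q - xc σ p) + e * (yc σ q - yc σ p) ≤ dist p q := by
  refine abs_le_of_sq_le_sq' ?_ dist_nonneg |>.2
  rw [dist_sq_xy h]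
  nlinarith [sq_nonneg (c * (yc σ q - yc σ p) - e * (xc σ q - xc σ p))]

theorem lt_dist_xy (h : σ * σ = 1) {c e : ℝ} (hce : c ^ 2 + e ^ 2 = 1) {p q : Plane}
    (hne : c * (yc σ q - yc σ p) - e * (xc σ q - xc σ p) ≠ 0) :
    c * (xc σ q - xc σ p) + e * (yc σ q - yc σ p) < dist p q := by
  refine abs_lt_of_sq_lt_sq' ?_ dist_nonneg |>.2
  rw [dist_sq_xy h]
  have := sq_pos_of_ne_zero hne
  nlinarith

/-- The unit vector from one point to another one on its right. -/
theorem exists_direction (h : σ * σ = 1) {p q : Plane} (hpq : xc σ p < xc σ q) :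
    ∃ c e : ℝ, c ^ 2 + e ^ 2 = 1 ∧ 0 < c ∧ 0 < dist p q ∧
      xc σ q - xc σ p = c * dist p q ∧ yc σ q - yc σ p = e * dist p q := by
  have hd : 0 < dist p q := dist_pos.2 (by rintro rfl; exact lt_irrefl _ hpq)
  have := dist_sq_xy h p q
  refine ⟨(xc σ q - xc σ p) / dist p q, (yc σ q - yc σ p) / dist p q, ?_,
    div_pos (by linarith) hd, hd, (div_mul_cancel₀ _ hd.ne').symm, (div_mul_cancel₀ _ hd.ne').symm⟩
  rw [div_pow, div_pow, ← add_div, ← this, div_self (by positivity)]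

/-- For unit vectors that point to the right, a larger slope means a larger `y`-coordinate. -/
theorem direction_mono {c e c' e' : ℝ} (h : c ^ 2 + e ^ 2 = 1) (h' : c' ^ 2 + e' ^ 2 = 1)
    (hc : 0 < c) (hc' : 0 < c') (hs : 0 ≤ c' * e - e' * c) : e' ≤ e := by
  by_contra! hn
  rcases le_or_gt 0 e with he | he
  · have : c' ≤ c := by
      by_contra! h1
      nlinarith
    nlinarith
  · rcases le_or_gt 0 e' with he' | he'
    · nlinarith
    · have : c ≤ c' := by
        by_contra! h1
        nlinarith
      nlinarith

/-- `PathTo R p z l`: there is a polygonal chain of length `l` from `p` to `z` in `R`. -/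
inductive PathTo (R : Set Plane) (p : Plane) : Plane → ℝ → Prop
  | refl : PathTo R p p 0
  | snoc {q z : Plane} {l : ℝ} : PathTo R p q l → segment ℝ q z ⊆ R → PathTo R p z (l + dist q z)

theorem PathTo.nonneg {R : Set Plane} {p z : Plane} {l : ℝ} (h : PathTo R p z l) : 0 ≤ l := by
  induction h with
  | refl => exact le_rfl
  | snoc _ _ ih => exact add_nonneg ih dist_nonneg

theorem PathTo.mem {R : Set Plane} {p z : Plane} {l : ℝ} (hp : p ∈ R) (h : PathTo R p z l) :
    z ∈ R := by
  cases h with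
  | refl => exact hp
  | snoc _ h => exact h (right_mem_segment _ _ _)

theorem exists_mem_segment_xc {p q : Plane} {c : ℝ} (h1 : xc σ p ≤ c)
    (h2 : c ≤ xc σ q) (hpq : xc σ p < xc σ q) : ∃ w ∈ segment ℝ p q, xc σ w = c := by
  refine ⟨p + ((c - xc σ p) / (xc σ q - xc σ p)) • (q - p), mem_segment_line.2 ⟨(c - xc σ p) / (xc σ q - xc σ p), ?_, ?_, rfl⟩, ?_⟩
  · exact div_nonneg (by linarith) (by linarith)
  · rw [div_le_one (by linarith)]; linarith
  · rw [xc_line, div_mul_cancel₀ _ (by linarith)]; ring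

/-- A chain can be cut where it crosses a vertical line. -/
theorem PathTo.cut {R : Set Plane} {p z : Plane} {l c : ℝ} (h : PathTo R p z l)
    (h1 : xc σ p ≤ c) (h2 : c ≤ xc σ z) :
    ∃ w l', PathTo R p w l' ∧ xc σ w = c ∧ l' + dist w z ≤ l := by
  induction h with
  | refl => exact ⟨p, 0, .refl, le_antisymm h1 h2, by simp⟩
  | @snoc q z l hq hs ih =>
    rcases le_or_gt c (xc σ q) with hc | hc
    · obtain ⟨w, l', hw, hwc, hl⟩ := ih hc
      exact ⟨w, l', hw, hwc, by linarith [dist_triangle w q z]⟩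
    · obtain ⟨w, hw, hwc⟩ := exists_mem_segment_xc hc.le h2 (hc.trans_le h2)
      have hqw : segment ℝ q w ⊆ segment ℝ q z :=
        (convex_segment q z).segment_subset (left_mem_segment _ _ _) hw
      refine ⟨w, l + dist q w, .snoc hq (hqw.trans hs), hwc, ?_⟩
      rw [add_assoc, dist_add_dist_of_mem_segment hw]

theorem pathLength_cons_cons (p q : Plane) (L : List Plane) :
    pathLength (p :: q :: L) = dist p q + pathLength (q :: L) := by
  unfold pathLength; simp

theorem pathLength_append (L L' : List Plane) (q : Plane) :
    pathLength (L ++ q :: L') = pathLength (L ++ [q]) + pathLength (q :: L') := by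
  induction L with
  | nil => simp [pathLength]
  | cons x L ih =>
    cases L with
    | nil => simp [pathLength]
    | cons y L =>
      simp only [List.cons_append, pathLength_cons_cons] at ih ⊢
      rw [ih]; ring

theorem pathTo_of_isChain {R : Set Plane} {p q : Plane} {L : List Plane}
    (h1 : (L ++ [q]).head? = some p) (h : (L ++ [q]).IsChain fun p q => segment ℝ p q ⊆ R) :
    PathTo R p q (pathLength (L ++ [q])) := by
  induction L using List.reverseRecOn generalizing q with
  | nil =>
    simp at h1
    subst h1
    simpa [pathLength] using PathTo.refl
  | append_singleton L x ih =>
    rw [List.append_assoc] at h1 h ⊢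
    simp only [List.singleton_append] at h1 h ⊢
    rw [pathLength_append]
    have hx : pathLength [x, q] = dist x q := by simp [pathLength]
    rw [hx]
    have h' := h
    rw [show L ++ [x, q] = (L ++ [x]) ++ [q] by simp, List.isChain_append] at h'
    refine .snoc (ih ?_ h'.1) ?_
    · cases L <;> simpa using h1
    · exact h'.2.2 x (by simp) q (by simp)

theorem PathTo.exists_list {R : Set Plane} {p z : Plane} {l : ℝ} (h : PathTo R p z l) :
    ∃ L, (L ++ [z]).head? = some p ∧ ((L ++ [z]).IsChain fun p q => segment ℝ p q ⊆ R) ∧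
      pathLength (L ++ [z]) = l := by
  induction h with
  | refl => exact ⟨[], by simp [pathLength]⟩
  | @snoc q z l _ hs ih =>
    obtain ⟨L, h1, h2, h3⟩ := ih
    refine ⟨L ++ [q], ?_, ?_, ?_⟩
    · rw [List.head?_append, h1]; rfl
    · rw [List.isChain_append]
      refine ⟨h2, by simp, ?_⟩
      intro x hx y hy
      simp at hx hy
      subst hx hy
      exact hs
    · rw [List.append_assoc, List.singleton_append, pathLength_append, h3]
      simp [pathLength]

/-! ### Shortest paths follow the tree -/

/-- The distance `D` of `u` from the root bounds the length of every path that ends to the right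
of `u`. The unit vector `(c, e)` is a direction such that the line through `u` in this direction
passes below all vertices to the left of `u`. The proof follows the path back to the vertical line
through `u`, where it passes below `u`, and turns the direction back to that of the tree edge
which ends in `u`. -/
theorem Upright.exists_dist (M : Upright a σ r s) (hR : region a = under a σ r s Set.univ)
    (u : Fin k) : ∃ D, PathTo (region a) (a r) (a u) D ∧ ∀ c e : ℝ, c ^ 2 + e ^ 2 = 1 → 0 < c →
      (∀ i, xc σ (a i) < xc σ (a u) →
        0 ≤ c * (yc σ (a i) - yc σ (a u)) - e * (xc σ (a i) - xc σ (a u))) →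
      ∀ z l, PathTo (region a) (a r) z l → xc σ (a u) ≤ xc σ z →
        D + (c * (xc σ z - xc σ (a u)) + e * (yc σ z - yc σ (a u))) ≤ l := by
  induction u using induction_left (a := a) (σ := σ) with
  | _ u ih =>
  have hrR : a r ∈ region a := hR ▸ M.vertex_mem_under r
  by_cases hu : u = r
  · subst hu
    refine ⟨0, .refl, fun c e hce _ _ z l hz hxz => ?_⟩
    obtain ⟨w, l', hw, -, hl⟩ := hz.cut (c := xc σ (a u)) le_rfl hxz
    have hdist : ∀ {z l}, PathTo (region a) (a u) z l → dist (a u) z ≤ l := by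
      intro z l h
      induction h with
      | refl => simp
      | @snoc q z l _ _ ih => linarith [dist_triangle (a u) q z]
    linarith [le_dist_xy M.sq hce (a u) z, hdist hz]
  obtain ⟨v, hv⟩ := M.exists_par hu
  obtain ⟨D, hD, hmin⟩ := ih v hv.1
  refine ⟨D + dist (a v) (a u), .snoc hD (M.par_segment hR hv), fun c e hce hc hsup z l hz hxz => ?_⟩
  obtain ⟨c', e', hce', hc', hd, hx, hy⟩ := exists_direction M.sq hv.1
  obtain ⟨w, l', hw, hwx, hl⟩ := hz.cut (M.left u) hxz
  have h1 := hmin c' e' hce' hc' (fun i hi => by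
    have h2 := hv.2 i (ne_of_xc_lt hi) (hi.trans hv.1)
    rw [orient_xy M.sq, hx, hy] at h2
    have h3 : 0 < dist (a v) (a u) *
      (c' * (yc σ (a i) - yc σ (a v)) - e' * (xc σ (a i) - xc σ (a v))) := by linarith
    exact (pos_of_mul_pos_right h3 hd.le).le) w l' hw (by rw [hwx]; exact hv.1.le)
  have hwy : yc σ w ≤ yc σ (a u) := M.yc_le_of_mem_under (hR ▸ hw.mem hrR) hwx
  have he : e' ≤ e := by
    refine direction_mono hce hce' hc hc' ?_
    have h2 := hsup v hv.1
    have h3 : 0 ≤ dist (a v) (a u) * (c' * e - e' * c) := by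
      linear_combination h2 - c * hy + e * hx
    exact nonneg_of_mul_nonneg_right h3 hd
  have h4 := le_dist_xy M.sq hce w z
  have h5 : c' * (xc σ (a u) - xc σ (a v)) + e' * (yc σ (a u) - yc σ (a v)) = dist (a v) (a u) := by
    rw [hx, hy]; linear_combination dist (a v) (a u) * hce'
  rw [hwx] at h1 h4
  nlinarith [mul_nonneg (sub_nonneg.2 he) (sub_nonneg.2 hwy)]

/-- The last edge of a shortest path leads from the parent of its end to its end. -/
theorem Upright.par_of_shortest (M : Upright a σ r s) (hR : region a = under a σ r s Set.univ)
    {u v : Fin k} (huv : u ≠ v) {l : ℝ} (hu : PathTo (region a) (a r) (a u) l)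
    (hs : segment ℝ (a u) (a v) ⊆ region a)
    (hmin : ∀ l', PathTo (region a) (a r) (a v) l' → l + dist (a u) (a v) ≤ l') : Par a σ u v := by
  have hrR : a r ∈ region a := hR ▸ M.vertex_mem_under r
  have hl := hu.nonneg
  have hpos : 0 < dist (a u) (a v) := dist_pos.2 fun e => huv (M.inj _ _ (by rw [e]))
  by_cases hv : v = r
  · subst hv
    have := hmin 0 .refl
    linarith
  obtain ⟨p, hp⟩ := M.exists_par hv
  by_cases hpu : p = u
  · rwa [← hpu]
  exfalso
  obtain ⟨D, hD, hlow⟩ := M.exists_dist hR p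
  obtain ⟨c, e, hce, hc, hd, hx, hy⟩ := exists_direction M.sq hp.1
  have h0 := hmin _ (.snoc hD (M.par_segment hR hp))
  have h5 : c * (xc σ (a v) - xc σ (a p)) + e * (yc σ (a v) - yc σ (a p)) = dist (a p) (a v) := by
    rw [hx, hy]; linear_combination dist (a p) (a v) * hce
  have hlow' := hlow c e hce hc (fun i hi => by
    have h2 := hp.2 i (ne_of_xc_lt hi) (hi.trans hp.1)
    rw [orient_xy M.sq, hx, hy] at h2
    have h3 : 0 < dist (a p) (a v) *
      (c * (yc σ (a i) - yc σ (a p)) - e * (xc σ (a i) - xc σ (a p))) := by linarith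
    exact (pos_of_mul_pos_right h3 hd.le).le)
  have hpv : p ≠ v := ne_of_xc_lt hp.1
  -- away from the line through `p` and `v`, the estimate of the remaining length is strict
  have hstrict : ∀ w, orient (a p) (a v) w ≠ 0 →
      c * (xc σ (a v) - xc σ w) + e * (yc σ (a v) - yc σ w) < dist w (a v) := by
    intro w hw
    refine lt_dist_xy M.sq hce fun h6 => hw ?_
    rw [orient_xy M.sq, hx, hy]
    linear_combination (-dist (a p) (a v)) * h6 + dist (a p) (a v) * c * hy -
      dist (a p) (a v) * e * hx
  rcases le_or_gt (xc σ (a p)) (xc σ (a u)) with h1 | h1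
  · have h2 := hlow' _ _ hu h1
    have h3 := hstrict (a u) (M.gp p v u hpv hpu huv.symm)
    nlinarith
  · obtain ⟨w, hw, hwx⟩ := exists_mem_segment_xc h1.le hp.1.le (h1.trans hp.1)
    have h2 := hlow' w _ (.snoc hu (((convex_segment _ _).segment_subset
      (left_mem_segment _ _ _) hw).trans hs)) hwx.ge
    have h3 := hstrict w (fun ho => by
      rw [orient_xy M.sq, hwx] at ho
      have h7 : xc σ (a v) - xc σ (a p) ≠ 0 := by linarith [hp.1]
      have h8 : w = a p := plane_ext_xy M.sq hwx (by
        have : (xc σ (a v) - xc σ (a p)) * (yc σ w - yc σ (a p)) = 0 := by linarith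
        linarith [(mul_eq_zero.1 this).resolve_left h7])
      rw [h8] at hw
      exact M.gp u v p huv (Ne.symm hpu) (Ne.symm hpv) (orient_of_mem_segment hw))
    have h4 := dist_add_dist_of_mem_segment hw
    nlinarith

theorem Upright.isChild_iff (M : Upright a σ r s) (hR : region a = under a σ r s Set.univ)
    {u v : Fin k} : IsChild a r u v ↔ Par a σ u v := by
  constructor
  · rintro ⟨huv, m, L, ⟨⟨h1, h2, h3⟩, hmin⟩, L1, L2, rfl⟩
    simp only [List.append_assoc, List.cons_append, List.nil_append] at h1 h2 h3 hmin
    rw [show L1 ++ a u :: a v :: L2 = (L1 ++ [a u]) ++ a v :: L2 by simp] at h1 h2 h3 hmin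
    rw [List.isChain_append] at h3
    obtain ⟨h4, h5, h6⟩ := h3
    rw [List.append_assoc, List.singleton_append, pathLength_append, pathLength_cons_cons] at hmin
    refine M.par_of_shortest hR huv (pathTo_of_isChain ?_ h4) (h6 (a u) (by simp) (a v) (by simp)) ?_
    · cases L1 <;> simpa using h1
    · intro l' hl'
      obtain ⟨L', g1, g2, g3⟩ := hl'.exists_list
      have := hmin (L' ++ a v :: L2) ⟨?_, ?_, ?_⟩
      · rw [pathLength_append L' L2 (a v), g3] at this
        linarith
      · cases L' <;> simpa using g1
      · rw [← h2, List.getLast?_append, List.getLast?_append]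
        simp [List.getLast?_cons]
      · rw [List.isChain_append] at g2 ⊢
        exact ⟨g2.1, h5, fun x hx y hy => g2.2.2 x hx y (by simpa using hy)⟩
  · intro h
    obtain ⟨D, hD, hlow⟩ := M.exists_dist hR u
    obtain ⟨L, g1, g2, g3⟩ := hD.exists_list
    obtain ⟨c, e, hce, hc, hd, hx, hy⟩ := exists_direction M.sq h.1
    refine ⟨ne_of_xc_lt h.1, v, L ++ [a u, a v], ⟨⟨?_, ?_, ?_⟩, ?_⟩, ⟨L, [], by simp⟩⟩
    · cases L <;> simpa using g1
    · simp
    · rw [show L ++ [a u, a v] = (L ++ [a u]) ++ [a v] by simp, List.isChain_append]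
      refine ⟨g2, by simp, ?_⟩
      intro x hx y hy
      simp at hx hy
      subst hx hy
      exact M.par_segment hR h
    · rintro L' ⟨f1, f2, f3⟩
      obtain ⟨L', rfl⟩ : ∃ L'', L' = L'' ++ [a v] := by
        have := List.dropLast_append_getLast? _ f2
        exact ⟨_, this.symm⟩
      have h1 := hlow c e hce hc (fun i hi => by
        have h2 := h.2 i (ne_of_xc_lt hi) (hi.trans h.1)
        rw [orient_xy M.sq, hx, hy] at h2
        have h3 : 0 < dist (a u) (a v) *
          (c * (yc σ (a i) - yc σ (a u)) - e * (xc σ (a i) - xc σ (a u))) := by linarith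
        exact (pos_of_mul_pos_right h3 hd.le).le) _ _ (pathTo_of_isChain f1 f3) h.1.le
      rw [pathLength_append, g3]
      have h5 : c * (xc σ (a v) - xc σ (a u)) + e * (yc σ (a v) - yc σ (a u)) =
          dist (a u) (a v) := by
        rw [hx, hy]; linear_combination dist (a u) (a v) * hce
      have h6 : pathLength [a u, a v] = dist (a u) (a v) := by simp [pathLength]
      linarith

/-! ### Funnels -/

/-- The vertices strictly between `u` and `j` lie above the line from `u` to `j`, and the line
from `u` to any of them passes below all vertices to the left of `u`. This holds for the vertices
`u` of the chain opposite to the apex `j` of a funnel. -/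
structure Funnel {k : ℕ} (a : Fin k → Plane) (σ : ℝ) (u j : Fin k) : Prop where
  lt : xc σ (a u) < xc σ (a j)
  left : ∀ i w, xc σ (a i) < xc σ (a u) → xc σ (a u) < xc σ (a w) → xc σ (a w) < xc σ (a j) →
    0 < orient (a u) (a w) (a i)
  between : ∀ w, xc σ (a u) < xc σ (a w) → xc σ (a w) < xc σ (a j) →
    0 < orient (a u) (a j) (a w)

/-- Among the vertices strictly between `u` and `j`, the one in the lowest direction from `u`
is `v`. -/
def Lowest {k : ℕ} (a : Fin k → Plane) (σ : ℝ) (u j v : Fin k) : Prop :=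
  xc σ (a u) < xc σ (a v) ∧ xc σ (a v) < xc σ (a j) ∧
    ∀ w, w ≠ v → xc σ (a u) < xc σ (a w) → xc σ (a w) < xc σ (a j) → 0 < orient (a u) (a v) (a w)

/-- `n` is the vertex next to the left of `j`. -/
def Adjacent {k : ℕ} (a : Fin k → Plane) (σ : ℝ) (n j : Fin k) : Prop :=
  xc σ (a n) < xc σ (a j) ∧ ∀ i, xc σ (a i) ≤ xc σ (a n) ∨ xc σ (a j) ≤ xc σ (a i)

/-- The funnel of `j` begins at the parent of `j`. -/
theorem Par.funnel {u j : Fin k} (h : Par a σ u j) : Funnel a σ u j := by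
  refine ⟨h.1, fun i w hi huw hwj => ?_, fun w huw hwj => h.2 w (ne_of_xc_lt huw).symm hwj⟩
  have h1 := h.2 i (ne_of_xc_lt hi) (by linarith)
  have h2 := h.2 w (ne_of_xc_lt huw).symm hwj
  have e := orient_slope σ (a u) (a j) (a w) (a i)
  have h3 := mul_pos (sub_pos.2 huw) h1
  have h4 := mul_pos (sub_pos.2 hi) h2
  have h5 := h.1
  by_contra! hc
  nlinarith

theorem Upright.exists_lowest (M : Upright a σ r s) {u j w : Fin k}
    (h1 : xc σ (a u) < xc σ (a w)) (h2 : xc σ (a w) < xc σ (a j)) : ∃ v, Lowest a σ u j v := by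
  obtain ⟨v, ⟨hv1, hv2⟩, hmin⟩ := Set.exists_min_image
    {w | xc σ (a u) < xc σ (a w) ∧ xc σ (a w) < xc σ (a j)}
    (fun i => (yc σ (a i) - yc σ (a u)) / (xc σ (a i) - xc σ (a u))) (Set.toFinite _) ⟨w, h1, h2⟩
  refine ⟨v, hv1, hv2, fun i hi h3 h4 => lt_of_le_of_ne ?_ (M.gp u v i ?_ ?_ (Ne.symm hi)).symm⟩
  · have := hmin i ⟨h3, h4⟩
    rw [div_le_div_iff₀ (by linarith) (by linarith)] at this
    rw [orient_xy M.sq]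
    linarith
  · exact ne_of_xc_lt hv1
  · exact ne_of_xc_lt h3

/-- The edge of the funnel from `u` to the lowest vertex is a tree edge. -/
theorem Upright.par_of_lowest (M : Upright a σ r s) {u j v : Fin k} (h : Funnel a σ u j)
    (hv : Lowest a σ u j v) : Par a σ u v := by
  refine ⟨hv.1, fun i hiu hiv => ?_⟩
  rcases lt_or_ge (xc σ (a i)) (xc σ (a u)) with h1 | h1
  · exact h.left i v h1 hv.1 hv.2.1
  · exact hv.2.2 i (ne_of_xc_lt hiv) (M.xc_lt h1 (Ne.symm hiu)) (hiv.trans hv.2.1)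

theorem Funnel.orient_lowest {u j v : Fin k} (h : Funnel a σ u j) (hv : Lowest a σ u j v) :
    orient (a u) (a v) (a j) < 0 := by
  have := h.between v hv.1 hv.2.1
  rw [orient_swap'] at this
  linarith

theorem Upright.funnel_of_lowest (M : Upright a σ r s) {u j v : Fin k} (h : Funnel a σ u j)
    (hv : Lowest a σ u j v) : Funnel a σ v j := by
  have huv := hv.1
  have hvj := hv.2.1
  refine ⟨hvj, fun i w hi hvw hwj => ?_, fun w hvw hwj => ?_⟩
  · have h1 := hv.2.2 w (ne_of_xc_lt hvw).symm (huv.trans hvw) hwj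
    by_cases hiu : i = u
    · subst hiu
      rw [← orient_rot]; exact h1
    have h2 := (M.par_of_lowest h hv).2 i hiu hi
    have e := orient_slope σ (a v) (a u) (a w) (a i)
    rw [orient_swap (a v) (a u) (a i), orient_swap (a v) (a u) (a w)] at e
    have h3 := mul_pos (sub_pos.2 hvw) h2
    have h4 := mul_pos (sub_pos.2 hi) h1
    by_contra! hc
    nlinarith
  · have h1 := hv.2.2 w (ne_of_xc_lt hvw).symm (huv.trans hvw) hwj
    have h2 := h.orient_lowest hv
    have e := orient_slope σ (a v) (a u) (a j) (a w)
    rw [orient_swap (a v) (a u) (a w), orient_swap (a v) (a u) (a j)] at e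
    have h3 := mul_pos (sub_pos.2 hvj) h1
    have h4 := mul_pos (sub_pos.2 hvw) (neg_pos.2 h2)
    by_contra! hc
    nlinarith

theorem Upright.child_lt_of_lowest (M : Upright a σ r s) {u j v c : Fin k} (h : Funnel a σ u j)
    (hv : Lowest a σ u j v) (hc : Par a σ v c) : xc σ (a c) < xc σ (a j) := by
  by_contra! hjc
  have h1 := hc.2 u (ne_of_xc_lt hv.1) (hv.1.trans hc.1)
  have h2 := h.orient_lowest hv
  have e1 : orient (a v) (a j) (a u) = orient (a u) (a v) (a j) := (orient_rot _ _ _).symm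
  by_cases hcj : c = j
  · subst hcj
    linarith
  have h3 := hc.2 j (ne_of_xc_lt hv.2.1).symm (M.xc_lt hjc (Ne.symm hcj))
  have e := orient_slope σ (a v) (a c) (a j) (a u)
  rw [e1] at e
  have h4 := mul_pos (sub_pos.2 hv.2.1) h1
  have h5 := mul_pos (sub_pos.2 hc.1) (neg_pos.2 h2)
  have h6 := mul_pos (sub_pos.2 hv.1) h3
  linarith

theorem Upright.child_le_lowest (M : Upright a σ r s) {u j v c : Fin k}
    (hv : Lowest a σ u j v) (hc : Par a σ u c) (hcj : xc σ (a c) < xc σ (a j)) (hne : c ≠ v) :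
    xc σ (a c) < xc σ (a v) := by
  by_contra! hvc
  have h1 := hc.2 v (ne_of_xc_lt hv.1).symm (M.xc_lt hvc (Ne.symm hne))
  have h2 := hv.2.2 c hne hc.1 hcj
  rw [orient_swap'] at h2
  linarith

/-! ### Answers of the angular sweeps -/

theorem line_inter_line {σ : ℝ} (h : σ * σ = 1) {p q e e' t : Plane} (hpq : xc σ p ≠ xc σ q)
    (hee : xc σ e ≠ xc σ e') (h1 : orient p q t = 0) (h2 : orient e e' t = 0)
    (hne : orient p q e ≠ orient p q e') :
    (line[ℝ, p, q] : Set Plane) ∩ (line[ℝ, e, e'] : Set Plane) = {t} := by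
  ext z
  constructor
  · rintro ⟨hz1, hz2⟩
    have hz1 := orient_of_mem_line hz1
    have hz := eq_line_of_orient h hee (orient_of_mem_line hz2)
    have ht := eq_line_of_orient h hee h2
    set c := (xc σ z - xc σ e) / (xc σ e' - xc σ e)
    set d := (xc σ t - xc σ e) / (xc σ e' - xc σ e)
    have hcd : c = d := by
      rw [hz, orient_line] at hz1
      rw [ht, orient_line] at h1
      have : (c - d) * (orient p q e' - orient p q e) = 0 := by linarith
      exact sub_eq_zero.1 ((mul_eq_zero.1 this).resolve_right (sub_ne_zero.2 hne.symm))
    rw [Set.mem_singleton_iff, hz, ht, hcd]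
  · rintro rfl
    exact ⟨mem_line_of_orient h hpq h1, mem_line_of_orient h hee h2⟩

/-- Two vertices hit first would be collinear with the centre of the sweep. -/
theorem Upright.sweepHits_unique (M : Upright a σ r s) {c w e e' j j' : Fin k}
    (h : SweepHits a c w e e' j) (h' : SweepHits a c w e e' j') : j = j' := by
  obtain ⟨t, ht, -, hj, x, hx, hxj, hxm⟩ := h
  obtain ⟨t', ht', -, hj', x', hx', hxj', hxm'⟩ := h'
  obtain rfl : t = t' := by
    have := ht.symm.trans ht'
    simpa using this
  obtain rfl : x = x' := le_antisymm (hxm _ _ hj' hx' hxj') (hxm' _ _ hj hx hxj)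
  by_contra hne
  refine M.gp c j j' (Ne.symm hj) (Ne.symm hj') hne ?_
  obtain ⟨l, -, -, h1⟩ := mem_segment_line.1 hxj
  obtain ⟨l', -, -, h2⟩ := mem_segment_line.1 hxj'
  rw [h1, h2]
  unfold orient
  simp only [PiLp.add_apply, PiLp.smul_apply, PiLp.sub_apply, smul_eq_mul]
  ring

theorem Upright.sweep_eq (M : Upright a σ r s) {c w e e' j : Fin k}
    (h : SweepHits a c w e e' j) : sweep a c w e e' = some j := by
  have hu : ∃! j, SweepHits a c w e e' j := ⟨j, h, fun _ h' => M.sweepHits_unique h' h⟩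
  unfold sweep
  rw [dif_pos hu]
  exact congrArg some (M.sweepHits_unique hu.choose_spec.1 h)

/-- Sweeping around a vertex `u` of the funnel with apex `j`, from `j` towards the vertex before
`j`, finds the next vertex of the funnel. -/
theorem Upright.sweep_lowest (M : Upright a σ r s) (hR : region a = under a σ r s Set.univ)
    {u j n v : Fin k} (h : Funnel a σ u j) (hn : Adjacent a σ n j) (hun : u ≠ n)
    (hv : Lowest a σ u j v) : sweep a u j j n = some v := by
  have huj := h.lt
  have hvn : xc σ (a v) ≤ xc σ (a n) := (hn.2 v).resolve_right (not_le.2 hv.2.1)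
  have hnn : 0 ≤ orient (a u) (a v) (a n) := by
    by_cases e : n = v
    · simp [e]
    · exact (hv.2.2 n e (hv.1.trans_le hvn) hn.1).le
  have hj := h.orient_lowest hv
  refine M.sweep_eq ⟨a j, ?_, ?_, (ne_of_xc_lt hv.1).symm, ?_⟩
  · refine line_inter_line M.sq huj.ne hn.1.ne' (by simp) (by simp) ?_
    rw [orient_self_right]
    exact (M.gp u j n (ne_of_xc_lt huj) hun (ne_of_xc_lt hn.1).symm).symm
  · exact M.segment_subset_region hR huj h.between
  · set p := orient (a u) (a v) (a j) with hp
    set q := orient (a u) (a v) (a n) with hq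
    have hd : 0 < q - p := by linarith
    -- the endpoint of the sweep reaches the line through `u` and `v` at this parameter
    have hxd : (-p / (q - p)) * (q - p) = -p := div_mul_cancel₀ _ hd.ne'
    have hx0 : 0 < -p / (q - p) := div_pos (by linarith) hd
    have hx1 : -p / (q - p) ≤ 1 := by rw [div_le_one hd]; linarith
    set x := -p / (q - p)
    refine ⟨x, hx0, ?_, ?_⟩
    · have hX := xc_line σ (a j) (a n) x
      have hX' : xc σ (a n) ≤ xc σ (a j + x • (a n - a j)) := by
        rw [hX]; nlinarith [hn.1]
      refine mem_segment_of_orient M.sq ?_ ?_ hv.1.le (hvn.trans hX')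
      · linarith [hv.1]
      · rw [orient_swap', orient_line, ← hp, ← hq]
        linear_combination -hxd
    · intro i y hi hy hmem
      by_contra! hyx
      obtain ⟨l, hl0, hl1, hl⟩ := mem_segment_line.1 hmem
      have hl0 : 0 < l := lt_of_le_of_ne hl0 (by
        rintro rfl
        exact hi (M.inj _ _ (by rw [hl]; simp)))
      have ho : orient (a u) (a v) (a i) < 0 := by
        rw [hl, orient_line, orient_line, orient_self_outer, ← hp, ← hq]
        have : y * (q - p) < x * (q - p) := mul_lt_mul_of_pos_right hyx hd
        nlinarith
      have hX := xc_line σ (a u) (a j + y • (a n - a j)) l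
      rw [← hl, xc_line] at hX
      have hun' : xc σ (a u) < xc σ (a n) := hv.1.trans_le hvn
      have h1 : xc σ (a u) < xc σ (a j) + y * (xc σ (a n) - xc σ (a j)) := by nlinarith [hn.1]
      have h2 : xc σ (a j) + y * (xc σ (a n) - xc σ (a j)) < xc σ (a j) := by nlinarith [hn.1]
      have h3 : xc σ (a u) < xc σ (a i) := by nlinarith
      have h4 : xc σ (a i) < xc σ (a j) := by nlinarith
      by_cases hiv : i = v
      · subst hiv; simp at ho
      · linarith [hv.2.2 i hiv h3 h4]

/-- The change of the affine function `orient b c` along a segment, compared with its change along another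
one with the same starting point. -/
theorem orient_affine (σ : ℝ) (p q z b c : Plane) :
    (xc σ z - xc σ p) * (orient b c q - orient b c p) =
      (xc σ q - xc σ p) * (orient b c z - orient b c p) - (xc σ c - xc σ b) * orient p q z := by
  unfold orient xc; ring

/-- A tree edge that does not lie on the base rises above it. -/
theorem Upright.base_lt (M : Upright a σ r s) {i j : Fin k} (h : Par a σ i j)
    (hne : i ≠ r ∨ j ≠ s) : orient (a r) (a s) (a i) < orient (a r) (a s) (a j) := by
  by_cases hi : i = r
  · subst hi
    rw [orient_self_outer]
    exact M.above j (ne_of_xc_lt h.1).symm (hne.resolve_left (by simp))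
  · have hri := M.xc_lt (M.left i) (Ne.symm hi)
    have h1 := h.2 r (Ne.symm hi) (hri.trans h.1)
    have e := orient_affine σ (a i) (a j) (a r) (a r) (a s)
    rw [orient_self_outer] at e
    have hg := M.above i hi (ne_of_xc_lt (h.1.trans_le (M.right j)))
    have h2 := mul_pos (sub_pos.2 M.lt_rs) h1
    have h3 := mul_pos (sub_pos.2 h.1) hg
    by_contra! hc
    nlinarith

/-- A tree edge that does not lie on the base, extended to the right, passes above `s`. -/
theorem Upright.orient_right_neg (M : Upright a σ r s) {i j : Fin k} (h : Par a σ i j)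
    (hne : i ≠ r ∨ j ≠ s) : orient (a i) (a j) (a s) < 0 := by
  have h1 := M.base_lt h hne
  have e := orient_affine σ (a i) (a j) (a s) (a r) (a s)
  rw [orient_self_right] at e
  have h2 := mul_pos (sub_pos.2 (h.1.trans_le (M.right j))) (sub_pos.2 h1)
  have h3 := mul_nonneg (sub_pos.2 h.1).le (M.base_nonneg i)
  have h4 := M.lt_rs
  by_contra! hc
  nlinarith

/-- Sweeping around `u`, from the point where the extension of an edge to a child `j` of `u` meets
the base towards the root, finds the parent of `u`. -/
theorem Upright.sweep_par (M : Upright a σ r s) (hR : region a = under a σ r s Set.univ)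
    {u j w : Fin k} (h : Par a σ u j) (hu : u ≠ r) (hw : Par a σ w u) :
    sweep a u j s r = some w := by
  have huj := h.1
  have hwu := hw.1
  have hrs := M.lt_rs
  have hus : u ≠ s := ne_of_xc_lt (huj.trans_le (M.right j))
  have hru := M.xc_lt (M.left u) (Ne.symm hu)
  have hjr : 0 < orient (a u) (a j) (a r) := h.2 r (Ne.symm hu) (hru.trans huj)
  have hjs := M.orient_right_neg h (Or.inl hu)
  have hbj := M.base_lt h (Or.inl hu)
  have hbw := M.base_lt hw (Or.inr hus)
  have hws := M.orient_right_neg hw (Or.inr hus)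
  have hwr : 0 ≤ orient (a w) (a u) (a r) := by
    by_cases e : r = w
    · simp [e]
    · exact (hw.2 r e hru).le
  have hgu := M.above u hu hus
  have hgw := M.base_nonneg w
  -- the starting point of the sweep
  have hμd : (orient (a u) (a j) (a r) / (orient (a u) (a j) (a r) - orient (a u) (a j) (a s))) *
      (orient (a u) (a j) (a r) - orient (a u) (a j) (a s)) = orient (a u) (a j) (a r) :=
    div_mul_cancel₀ _ (by linarith)
  have hμ0 : 0 < orient (a u) (a j) (a r) / (orient (a u) (a j) (a r) - orient (a u) (a j) (a s)) :=
    div_pos hjr (by linarith)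
  have hμ1 : orient (a u) (a j) (a r) / (orient (a u) (a j) (a r) - orient (a u) (a j) (a s)) ≤ 1 := by
    rw [div_le_one (by linarith)]; linarith
  set μ := orient (a u) (a j) (a r) / (orient (a u) (a j) (a r) - orient (a u) (a j) (a s))
  obtain ⟨t, ht⟩ : ∃ t, t = a r + μ • (a s - a r) := ⟨_, rfl⟩
  have htu : orient (a u) (a j) t = 0 := by rw [ht, orient_line]; linarith
  have htb : orient (a r) (a s) t = 0 := by rw [ht, orient_line]; simp
  have hts : t ∈ segment ℝ (a r) (a s) := mem_segment_line.2 ⟨μ, hμ0.le, hμ1, ht⟩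
  have hxt : xc σ t < xc σ (a u) := by
    have e := orient_affine σ (a u) (a j) t (a r) (a s)
    rw [htu, htb] at e
    have h1 := mul_pos (sub_pos.2 huj) hgu
    by_contra! hc
    nlinarith
  have hti : ∀ i, 0 < orient (a u) (a j) (a i) → 0 < orient t (a u) (a i) := by
    intro i hi
    have e := orient_slope σ (a u) (a j) t (a i)
    rw [htu, orient_swap (a u) t] at e
    have h1 := mul_pos (sub_pos.2 hxt) hi
    by_contra! hc
    nlinarith
  refine M.sweep_eq ⟨t, ?_, ?_, ne_of_xc_lt hwu, ?_⟩
  · refine line_inter_line M.sq huj.ne hrs.ne' htu ?_ (by linarith)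
    rw [orient_swap, htb, neg_zero]
  · rw [segment_symm, hR]
    refine M.segment_subset_under hxt (M.outline_subset_under (Or.inl hts)) (M.vertex_mem_under u) ?_
    intro i _ _ hiu
    exact (hti i (h.2 i (ne_of_xc_lt hiu) (hiu.trans huj))).le
  -- the endpoint of the sweep reaches the line through `u` and `w` at the parameter `μ - ν`
  have hνd : (orient (a w) (a u) (a r) / (orient (a w) (a u) (a r) - orient (a w) (a u) (a s))) *
      (orient (a w) (a u) (a r) - orient (a w) (a u) (a s)) = orient (a w) (a u) (a r) :=
    div_mul_cancel₀ _ (by linarith)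
  set ν := orient (a w) (a u) (a r) / (orient (a w) (a u) (a r) - orient (a w) (a u) (a s))
  have hf : ∀ y : ℝ, t + y • (a r - a s) = a r + (μ - y) • (a s - a r) := by
    intro y; rw [ht]; module
  have hwt : orient (a w) (a u) t < 0 := by
    have h1 := hti w (h.2 w (ne_of_xc_lt hwu) (hwu.trans huj))
    rw [orient_rot, orient_swap] at h1
    linarith
  have hνμ : ν < μ := by
    rw [ht, orient_line] at hwt
    by_contra! hc
    nlinarith
  refine ⟨μ - ν, by linarith, ?_, ?_⟩
  · rw [hf, sub_sub_cancel]
    set q := a r + ν • (a s - a r) with hq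
    have hq1 : orient (a w) (a u) q = 0 := by rw [hq, orient_line]; linarith
    have hq2 : orient (a r) (a s) q = 0 := by rw [hq, orient_line]; simp
    have hxq : xc σ q ≤ xc σ (a w) := by
      have e := orient_affine σ (a w) (a u) q (a r) (a s)
      rw [hq1, hq2] at e
      have h1 := mul_nonneg (sub_pos.2 hwu).le hgw
      by_contra! hc
      nlinarith
    rw [segment_symm]
    refine mem_segment_of_orient M.sq (by linarith) ?_ hxq hwu.le
    rw [orient_rot, orient_swap, hq1, neg_zero]
  · intro i y hi hy hmem
    by_contra! hyx
    rw [hf] at hmem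
    obtain ⟨l, hl0, hl1, hl⟩ := mem_segment_line.1 hmem
    have hl0 : 0 < l := lt_of_le_of_ne hl0 (by
      rintro rfl
      exact hi (M.inj _ _ (by rw [hl]; simp)))
    have ho : orient (a w) (a u) (a i) < 0 := by
      rw [hl, orient_line, orient_line, orient_self_right]
      have h1 : ν * (orient (a w) (a u) (a r) - orient (a w) (a u) (a s)) <
          (μ - y) * (orient (a w) (a u) (a r) - orient (a w) (a u) (a s)) :=
        mul_lt_mul_of_pos_right (by linarith) (by linarith)
      nlinarith
    have hX := xc_line σ (a u) (a r + (μ - y) • (a s - a r)) l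
    rw [← hl, xc_line] at hX
    have hXt : xc σ t = xc σ (a r) + μ * (xc σ (a s) - xc σ (a r)) := by rw [ht, xc_line]
    have h2 : (μ - y) * (xc σ (a s) - xc σ (a r)) < μ * (xc σ (a s) - xc σ (a r)) :=
      mul_lt_mul_of_pos_right (by linarith) (by linarith)
    have h3 : xc σ (a i) < xc σ (a u) := by
      have := mul_pos hl0 (sub_pos.2 (show xc σ (a r) + (μ - y) * (xc σ (a s) - xc σ (a r)) <
        xc σ (a u) by linarith))
      linarith
    by_cases hiw : i = w
    · subst hiw; simp at ho
    · linarith [hw.2 i hiw h3]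

/-! ### Unfinished Euler tours -/

/-- `cs` lists the children of `u` to the left of `j` in counterclockwise order around `u`. -/
def LeftChildren {k : ℕ} (a : Fin k → Plane) (σ : ℝ) (u j : Fin k) (cs : List (Fin k)) : Prop :=
  (∀ v, v ∈ cs ↔ Par a σ u v ∧ xc σ (a v) < xc σ (a j)) ∧
    cs.Pairwise fun v w => 0 < orient (a u) (a v) (a w)

/-- `t` is the part of the Euler tour that follows the subtree of `j`: on the way from `j` to the
root, the subtrees of the later siblings are visited. -/
inductive Rest {k : ℕ} (a : Fin k → Plane) (σ : ℝ) (r : Fin k) : Fin k → List (Fin k) → Prop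
  | root : Rest a σ r r []
  | step {u j : Fin k} {cs t t' : List (Fin k)} : Par a σ u j → LeftChildren a σ u j cs →
      TourThrough a r u cs t → Rest a σ r u t' → Rest a σ r j (t ++ t')

/-- `t` is the beginning of the Euler tour up to the end of the subtree of `j`. -/
def TourAfter {k : ℕ} (a : Fin k → Plane) (σ : ℝ) (r j : Fin k) (t : List (Fin k)) : Prop :=
  ∀ t', Rest a σ r j t' → IsEulerTour a r (t ++ t')

/-- `t` is the beginning of the Euler tour up to the visit of `u` that precedes the visits of its
children to the left of `j`. -/
def TourAt {k : ℕ} (a : Fin k → Plane) (σ : ℝ) (r u j : Fin k) (t : List (Fin k)) : Prop :=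
  ∀ cs t' t'', LeftChildren a σ u j cs → TourThrough a r u cs (u :: t') → Rest a σ r u t'' →
    IsEulerTour a r (t ++ (t' ++ t''))

theorem Upright.not_par_root (M : Upright a σ r s) (u : Fin k) : ¬ Par a σ u r := fun h =>
  absurd h.1 (not_lt.2 (M.left u))

theorem Upright.rest_root (M : Upright a σ r s) {t : List (Fin k)} (h : Rest a σ r r t) :
    t = [] := by
  cases h with
  | root => rfl
  | step h => exact absurd h (M.not_par_root _)

theorem Upright.par_base (M : Upright a σ r s) : Par a σ r s :=
  ⟨M.lt_rs, fun i hi his => M.above i hi (ne_of_xc_lt his)⟩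

theorem Upright.isChildList (M : Upright a σ r s) (hR : region a = under a σ r s Set.univ)
    {u j : Fin k} {cs : List (Fin k)} (h : LeftChildren a σ u j cs)
    (hj : ∀ c, Par a σ u c → xc σ (a c) < xc σ (a j)) : IsChildList a r u cs := by
  refine ⟨fun v => ?_, h.2⟩
  rw [h.1, M.isChild_iff hR]
  exact ⟨fun h => h.1, fun h => ⟨h, hj v h⟩⟩

/-- The child `s` of the root is a leaf, and it is the first child to be visited. -/
theorem Upright.tourAfter_start (M : Upright a σ r s) (hR : region a = under a σ r s Set.univ) :
    TourAfter a σ r s [r, s] := by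
  intro t' h
  cases h with
  | root => exact absurd rfl M.ne
  | @step u _ cs t t' hp hcs ht hrest =>
    obtain rfl := hp.unique M.par_base
    rw [M.rest_root hrest, List.append_nil]
    refine ⟨s :: cs, ⟨fun v => ?_, ?_⟩, .cons u s cs [] [s] t ⟨fun v => ?_, .nil⟩ (.nil s) ht⟩
    · rw [M.isChild_iff hR, List.mem_cons, hcs.1]
      constructor
      · rintro (rfl | h)
        · exact hp
        · exact h.1
      · intro h
        by_cases hv : v = s
        · exact Or.inl hv
        · exact Or.inr ⟨h, M.xc_lt (M.right v) hv⟩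
    · refine List.pairwise_cons.2 ⟨fun w hw => ?_, hcs.2⟩
      have := (hcs.1 w).1 hw
      exact M.above w (ne_of_xc_lt this.1.1).symm (ne_of_xc_lt this.2)
    · rw [M.isChild_iff hR]
      refine ⟨fun h => absurd h (by simp), fun h => absurd h.1 (not_lt.2 (M.right v))⟩

theorem TourAfter.climb {u j : Fin k} {t : List (Fin k)} (h : TourAfter a σ r j t)
    (hp : Par a σ u j) : TourAt a σ r u j (t ++ [u]) := by
  intro cs t' t'' hcs ht hrest
  have := h _ (.step hp hcs ht hrest)
  simpa using this

/-- All children of the lowest vertex `v` of the funnel lie to the left of the apex, so that the visit of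
`v` is followed by the whole subtree of `v`, and then by the later children of `u`. -/
theorem Upright.tourAt_descend (M : Upright a σ r s) (hR : region a = under a σ r s Set.univ)
    {u j v : Fin k} {t : List (Fin k)} (h : TourAt a σ r u j t) (hf : Funnel a σ u j)
    (hv : Lowest a σ u j v) : TourAt a σ r v j (t ++ [v]) := by
  intro cs t' t'' hcs ht hrest
  have hp := M.par_of_lowest hf hv
  cases hrest with
  | root => exact absurd hp (M.not_par_root _)
  | @step w _ cs' t1 t2 hw hcs' ht1 ht2 =>
    obtain rfl := hw.unique hp
    have hlist : LeftChildren a σ w j (v :: cs') := by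
      refine ⟨fun c => ?_, List.pairwise_cons.2 ⟨fun c hc => ?_, hcs'.2⟩⟩
      · rw [List.mem_cons, hcs'.1]
        constructor
        · rintro (rfl | hc)
          · exact ⟨hp, hv.2.1⟩
          · exact ⟨hc.1, hc.2.trans hv.2.1⟩
        · rintro ⟨hc1, hc2⟩
          by_cases hcv : c = v
          · exact Or.inl hcv
          · exact Or.inr ⟨hc1, M.child_le_lowest hv hc1 hc2 hcv⟩
      · have hc := (hcs'.1 c).1 hc
        exact hv.2.2 c (ne_of_xc_lt hc.2) hc.1.1 (hc.2.trans hv.2.1)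
    have := h _ _ _ hlist (.cons w v cs' cs _ t1
      (M.isChildList hR hcs fun c hc => M.child_lt_of_lowest hf hv hc) ht ht1) ht2
    simpa using this

theorem TourAt.finish {n j : Fin k} {t : List (Fin k)} (h : TourAt a σ r n j t)
    (hn : Adjacent a σ n j) : TourAfter a σ r n t := by
  intro t' ht'
  refine h [] [] t' ⟨fun v => ?_, .nil⟩ (.nil n) ht'
  refine ⟨fun hv => absurd hv (by simp), fun hv => ?_⟩
  rcases hn.2 v with h1 | h1
  · exact absurd hv.1.1 (not_lt.2 h1)
  · exact absurd hv.2 (not_lt.2 h1)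

/-! ### The current chain -/

/-- The chain of the tree path to `u` and of all vertices from `j` on. -/
def chain {k : ℕ} (a : Fin k → Plane) (σ : ℝ) (u j : Fin k) : Set (Fin k) :=
  {i | xc σ (a j) ≤ xc σ (a i) ∨ Relation.ReflTransGen (Par a σ) i u}

theorem xc_le_of_ancestor {i u : Fin k} (h : Relation.ReflTransGen (Par a σ) i u) :
    xc σ (a i) ≤ xc σ (a u) := by
  induction h with
  | refl => exact le_rfl
  | tail _ h ih => exact ih.trans h.1.le

theorem Par.ancestor_iff {u v i : Fin k} (h : Par a σ u v) :
    Relation.ReflTransGen (Par a σ) i v ↔ i = v ∨ Relation.ReflTransGen (Par a σ) i u := by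
  constructor
  · intro hi
    rcases hi.cases_tail with rfl | ⟨w, hw, hwv⟩
    · exact Or.inl rfl
    · rw [h.unique hwv]; exact Or.inr hw
  · rintro (rfl | hi)
    · exact .refl
    · exact hi.tail h

theorem Upright.ancestor_root (M : Upright a σ r s) {i : Fin k} :
    Relation.ReflTransGen (Par a σ) i r ↔ i = r := by
  constructor
  · intro hi
    rcases hi.cases_tail with rfl | ⟨w, -, hw⟩
    · rfl
    · exact absurd hw (M.not_par_root _)
  · rintro rfl; exact .refl

theorem consec_chain {u j : Fin k} (h : xc σ (a u) < xc σ (a j)) :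
    Consec a σ (chain a σ u j) u j := by
  refine ⟨Or.inr .refl, Or.inl le_rfl, h, ?_⟩
  rintro m (hm | hm)
  · exact Or.inr hm
  · exact Or.inl (xc_le_of_ancestor hm)

theorem Par.chain_insert {u v j : Fin k} (h : Par a σ u v) :
    chain a σ v j = insert v (chain a σ u j) := by
  ext i
  simp only [chain, Set.mem_insert_iff, Set.mem_ofPred_eq, h.ancestor_iff]
  tauto

/-- When the leaf `n` becomes the apex, the chain does not change. -/
theorem Upright.chain_finish (M : Upright a σ r s) {u n j : Fin k} (h : Par a σ u n)
    (hn : Adjacent a σ n j) : chain a σ u n = chain a σ n j := by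
  ext i
  simp only [chain, Set.mem_ofPred_eq, h.ancestor_iff]
  have : xc σ (a n) ≤ xc σ (a i) ↔ i = n ∨ xc σ (a j) ≤ xc σ (a i) := by
    constructor
    · intro h1
      rcases hn.2 i with h2 | h2
      · exact Or.inl (M.inj _ _ (le_antisymm h2 h1))
      · exact Or.inr h2
    · rintro (rfl | h1)
      · exact le_rfl
      · exact hn.1.le.trans h1
  rw [this]
  tauto

theorem Upright.mem_chain_base (M : Upright a σ r s) (i : Fin k) :
    i ∈ chain a σ r s ↔ i = r ∨ i = s := by
  simp only [chain, Set.mem_ofPred_eq, M.ancestor_root]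
  constructor
  · rintro (h | h)
    · exact Or.inr (M.inj _ _ (le_antisymm (M.right i) h))
    · exact Or.inl h
  · rintro (rfl | rfl)
    · exact Or.inr rfl
    · exact Or.inl le_rfl

theorem Upright.chain_root (M : Upright a σ r s) {j : Fin k} (hn : Adjacent a σ r j) :
    chain a σ r j = Set.univ := by
  ext i
  simp only [chain, Set.mem_ofPred_eq, M.ancestor_root, Set.mem_univ, iff_true]
  rcases hn.2 i with h | h
  · exact Or.inr (M.inj _ _ (le_antisymm h (M.left i)))
  · exact Or.inl h

/-! ### The program -/

/-- The triangulation program. Registers `0` and `1` hold the endpoints of the base; register `2`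
holds the apex of the funnel, which is the vertex whose subtree has been completed last,
register `3` the current vertex of the tour, register `4` the next vertex in the scan, and
register `5` the answer of a sweep.

At `3` the tour steps up from the apex, at `5` it tests whether the current vertex
is complete; if not, it descends along the funnel (`6`), and if so, the current vertex becomes the
apex (`12`). At `17` a leaf has been reached, which becomes the apex. -/
def program : Program 6 :=
  [.visit 0, .visit 1, .copy 3 0,
    .visit 3, .advance 4,
    .jumpEq 4 3 12, .sweep 5 3 2 2 4, .output 2 3 5, .visit 5, .jumpEq 5 4 17, .copy 3 5, .jumpEq 0 0 5,
    .jumpEq 3 0 19, .sweep 5 3 2 1 0, .copy 2 3, .copy 3 5, .jumpEq 0 0 3,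
    .copy 2 4, .jumpEq 0 0 3,
    .halt]

/-- The program can get from the first configuration to the second one. -/
def Reach {k : ℕ} (a : Fin k → Plane) : Config 6 k → Config 6 k → Prop :=
  Relation.ReflTransGen fun c₁ c₂ => step program a c₁ = some c₂

theorem reach_start [NeZero k] (a : Fin k → Plane) :
    ∃ reg : Fin 6 → Fin k, Reach a (Config.start 6 a) ⟨3, reg, 0, 0, 3, [], [root a, scanStart a]⟩ ∧
      reg 0 = root a ∧ reg 1 = scanStart a ∧ reg 2 = scanStart a ∧ reg 3 = root a := by
  refine ⟨Function.update (fun i => if i.val = 0 then root a else scanStart a) 3 (root a), ?_,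
    rfl, rfl, rfl, rfl⟩
  refine .head (b := ⟨1, _, 0, 0, 1, [], [root a]⟩) rfl ?_
  refine .head (b := ⟨2, _, 0, 0, 2, [], [root a, scanStart a]⟩) rfl ?_
  exact .single rfl

theorem reach_climb {reg : Fin 6 → Fin k} {h : Fin k} {sw tm : ℕ}
    {out : List (Fin k × Fin k × Fin k)} {tour : List (Fin k)} (hk : h.val + 1 < k) :
    Reach a ⟨3, reg, h, sw, tm, out, tour⟩
      ⟨5, Function.update reg 4 (ccw a ⟨h.val + 1, hk⟩), ⟨h.val + 1, hk⟩, sw, tm + 2, out,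
        tour ++ [reg 3]⟩ := by
  refine .head (b := ⟨4, reg, h, sw, tm + 1, out, tour ++ [reg 3]⟩) rfl (.single ?_)
  simp [step, program, Config.goto, hk]

theorem reach_sweep {reg : Fin 6 → Fin k} {h v : Fin k} {sw tm : ℕ}
    {out : List (Fin k × Fin k × Fin k)} {tour : List (Fin k)} (hne : reg 4 ≠ reg 3)
    (hv : sweep a (reg 3) (reg 2) (reg 2) (reg 4) = some v) :
    Reach a ⟨5, reg, h, sw, tm, out, tour⟩
      ⟨9, Function.update reg 5 v, h, sw + 1, tm + 3, out ++ [(reg 2, reg 3, v)],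
        tour ++ [v]⟩ := by
  refine .head (b := ⟨6, reg, h, sw, tm + 1, out, tour⟩) ?_ ?_
  · simp [step, program, Config.goto, hne]
  refine .head (b := ⟨7, Function.update reg 5 v, h, sw + 1, tm + 1, out, tour⟩) ?_ ?_
  · simp [step, program, hv]
  refine .head (b := ⟨8, Function.update reg 5 v, h, sw + 1, tm + 2, out ++ [(reg 2, reg 3, v)], tour⟩)
    rfl (.single rfl)

theorem reach_descend {reg : Fin 6 → Fin k} {h : Fin k} {sw tm : ℕ}
    {out : List (Fin k × Fin k × Fin k)} {tour : List (Fin k)} (hne : reg 5 ≠ reg 4) :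
    Reach a ⟨9, reg, h, sw, tm, out, tour⟩
      ⟨5, Function.update reg 3 (reg 5), h, sw, tm + 3, out, tour⟩ := by
  refine .head (b := ⟨10, reg, h, sw, tm + 1, out, tour⟩) ?_ ?_
  · simp [step, program, Config.goto, hne]
  refine .head (b := ⟨11, Function.update reg 3 (reg 5), h, sw, tm + 2, out, tour⟩) rfl (.single ?_)
  simp [step, program, Config.goto]

theorem reach_leaf {reg : Fin 6 → Fin k} {h : Fin k} {sw tm : ℕ}
    {out : List (Fin k × Fin k × Fin k)} {tour : List (Fin k)} (he : reg 5 = reg 4) :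
    Reach a ⟨9, reg, h, sw, tm, out, tour⟩
      ⟨3, Function.update reg 2 (reg 4), h, sw, tm + 3, out, tour⟩ := by
  refine .head (b := ⟨17, reg, h, sw, tm + 1, out, tour⟩) ?_ ?_
  · simp [step, program, Config.goto, he]
  refine .head (b := ⟨18, Function.update reg 2 (reg 4), h, sw, tm + 2, out, tour⟩) rfl (.single ?_)
  simp [step, program, Config.goto]

theorem reach_complete {reg : Fin 6 → Fin k} {h v : Fin k} {sw tm : ℕ}
    {out : List (Fin k × Fin k × Fin k)} {tour : List (Fin k)} (he : reg 4 = reg 3)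
    (hr : reg 3 ≠ reg 0) (hv : sweep a (reg 3) (reg 2) (reg 1) (reg 0) = some v) :
    Reach a ⟨5, reg, h, sw, tm, out, tour⟩
      ⟨3, Function.update (Function.update (Function.update reg 5 v) 2 (reg 3)) 3 v, h, sw + 1,
        tm + 5, out, tour⟩ := by
  refine .head (b := ⟨12, reg, h, sw, tm + 1, out, tour⟩) ?_ ?_
  · simp [step, program, Config.goto, he]
  refine .head (b := ⟨13, reg, h, sw, tm + 2, out, tour⟩) ?_ ?_
  · simp [step, program, Config.goto, hr]
  refine .head (b := ⟨14, Function.update reg 5 v, h, sw + 1, tm + 2, out, tour⟩) ?_ ?_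
  · simp [step, program, hv]
  refine .head (b := ⟨15, Function.update (Function.update reg 5 v) 2 (reg 3), h, sw + 1, tm + 3,
    out, tour⟩) rfl ?_
  refine .head (b := ⟨16, Function.update (Function.update (Function.update reg 5 v) 2 (reg 3)) 3 v,
    h, sw + 1, tm + 4, out, tour⟩) rfl (.single ?_)
  simp [step, program, Config.goto]

theorem reach_halt {reg : Fin 6 → Fin k} {h : Fin k} {sw tm : ℕ}
    {out : List (Fin k × Fin k × Fin k)} {tour : List (Fin k)} (he : reg 4 = reg 3)
    (hr : reg 3 = reg 0) :
    Reach a ⟨5, reg, h, sw, tm, out, tour⟩ ⟨19, reg, h, sw, tm + 2, out, tour⟩ := by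
  refine .head (b := ⟨12, reg, h, sw, tm + 1, out, tour⟩) ?_ (.single ?_)
  · simp [step, program, Config.goto, he]
  · simp [step, program, Config.goto, hr]

/-! ### The invariants -/

/-- The invariant before a step up the tree: the subtree of the apex is complete. -/
structure AtClimb {k : ℕ} (a : Fin k → Plane) (σ : ℝ) (r s : Fin k) (c : Config 6 k) : Prop where
  pc : c.pc = 3
  root : c.reg 0 = r
  start : c.reg 1 = s
  apex : c.reg 2 = ccw a c.head
  par : Par a σ (c.reg 3) (c.reg 2)
  triangulates : Triangulates a σ r s (chain a σ (c.reg 3) (c.reg 2)) c.triangles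
  tour : TourAfter a σ r (c.reg 2) c.tour
  sweeps : c.sweeps ≤ c.head + c.triangles.length + 1
  time : c.time ≤ 7 * c.head + 6 * c.triangles.length + 3

/-- The invariant after a visit of a vertex that may have further children. -/
structure AtVertex {k : ℕ} (a : Fin k → Plane) (σ : ℝ) (r s : Fin k) (c : Config 6 k) : Prop where
  pc : c.pc = 5
  root : c.reg 0 = r
  start : c.reg 1 = s
  next : c.reg 4 = ccw a c.head
  adjacent : Adjacent a σ (c.reg 4) (c.reg 2)
  funnel : Funnel a σ (c.reg 3) (c.reg 2)
  par : c.reg 4 = c.reg 3 → Par a σ (c.reg 3) (c.reg 2)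
  triangulates : Triangulates a σ r s (chain a σ (c.reg 3) (c.reg 2)) c.triangles
  tour : TourAt a σ r (c.reg 3) (c.reg 2) c.tour
  sweeps : c.sweeps ≤ c.head + c.triangles.length
  time : c.time + 2 ≤ 7 * c.head + 6 * c.triangles.length

theorem adjacent_ccw (hA : StrictAnti fun i => xc σ (a (ccw a i))) (h : Fin k)
    (hk : h.val + 1 < k) : Adjacent a σ (ccw a ⟨h.val + 1, hk⟩) (ccw a h) := by
  have hsurj : Function.Surjective (ccw a) := Finite.surjective_of_injective fun i j e =>
    hA.injective (by simp only [e])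
  refine ⟨hA (by rw [Fin.lt_def]; simp), fun i => ?_⟩
  obtain ⟨h', rfl⟩ := hsurj i
  rcases le_or_gt h' h with hh | hh
  · exact Or.inr (hA.antitone hh)
  · exact Or.inl (hA.antitone (by rw [Fin.le_def]; simpa using hh))

/-- The two instructions of a step up the tree: visit the parent of the apex and advance the scan. -/
theorem Upright.climb [NeZero k] (M : Upright a σ r s)
    (hA : StrictAnti fun i => xc σ (a (ccw a i))) (hr : ccw a (Fin.rev 0) = r) {c : Config 6 k}
    (hc : AtClimb a σ r s c) : ∃ c', Reach a c c' ∧ AtVertex a σ r s c' ∧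
      c'.head.val = c.head.val + 1 ∧ c'.triangles = c.triangles := by
  obtain ⟨pc, reg, h, sw, tm, out, tour⟩ := c
  obtain ⟨h1, h2, h3, h4, h5, h6, h7, h8, h9⟩ := hc
  dsimp only at h1 h2 h3 h4 h5 h6 h7 h8 h9
  subst h1
  have hk : h.val + 1 < k := by
    by_contra hn
    have : h = Fin.rev 0 := by rw [Fin.ext_iff, Fin.val_rev]; simp; omega
    rw [this, hr] at h4
    rw [h4] at h5
    exact M.not_par_root _ h5
  refine ⟨_, reach_climb hk, ⟨rfl, h2, h3, by simp, ?_, h5.funnel, fun _ => h5, h6, ?_, ?_, ?_⟩,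
    rfl, rfl⟩
  · simpa [h4] using adjacent_ccw hA h hk
  · exact h7.climb h5
  · simp only [Config.triangles] at h8 ⊢
    omega
  · simp only [Config.triangles] at h9 ⊢
    omega

/-- From a vertex of the tour, the program comes to another one after it has advanced the scan or output a
triangle, or it halts. -/
theorem Upright.run_vertex [NeZero k] (M : Upright a σ r s)
    (hR : region a = under a σ r s Set.univ)
    (hA : StrictAnti fun i => xc σ (a (ccw a i))) (hr : ccw a (Fin.rev 0) = r) {c : Config 6 k}
    (hc : AtVertex a σ r s c) :
    (∃ c', Reach a c c' ∧ AtVertex a σ r s c' ∧ c.head.val + c.triangles.length <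
      c'.head.val + c'.triangles.length) ∨
    ∃ c', Reach a c c' ∧ c'.pc = 19 ∧ c'.head = Fin.rev 0 ∧
      Triangulates a σ r s Set.univ c'.triangles ∧ IsEulerTour a r c'.tour ∧
      c'.sweeps ≤ c'.head + c'.triangles.length ∧
      c'.time ≤ 7 * c'.head + 6 * c'.triangles.length := by
  obtain ⟨pc, reg, h, sw, tm, out, tour⟩ := c
  obtain ⟨h1, h2, h3, h4, h5, h6, h6', h7, h8, h9, h10⟩ := hc
  dsimp only at h1 h2 h3 h4 h5 h6 h6' h7 h8 h9 h10
  subst h1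
  by_cases hun : reg 4 = reg 3
  · -- the current vertex is complete
    by_cases hur : reg 3 = reg 0
    · right
      rw [hun] at h5 h4
      have hur' := hur.trans h2
      rw [hur'] at h4 h5 h7 h8
      refine ⟨_, reach_halt hun hur, rfl, ?_, ?_, ?_, h9, h10⟩
      · have hinj : Function.Injective (ccw a) := fun i j e => hA.injective (by simp only [e])
        exact hinj (h4.symm.trans hr.symm)
      · rw [← M.chain_root h5]; exact h7
      · have := (h8.finish h5) [] .root
        simpa using this
    · left
      have hpar := h6' hun
      have hur' : reg 3 ≠ r := fun e => hur (e.trans h2.symm)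
      obtain ⟨w, hw⟩ := M.exists_par hur'
      have hsw := M.sweep_par hR hpar hur' hw
      rw [← h2, ← h3] at hsw
      rw [hun] at h5 h4
      have hcl : AtClimb a σ r s ⟨3, Function.update (Function.update (Function.update reg 5 w) 2
          (reg 3)) 3 w, h, sw + 1, tm + 5, out, tour⟩ := by
        refine ⟨rfl, h2, h3, h4, hw, ?_, h8.finish h5, Nat.succ_le_succ h9, ?_⟩
        · have := M.chain_finish hw h5
          rw [← this] at h7
          exact h7
        · simp only [Config.triangles] at h10 ⊢
          omega
      obtain ⟨c', hc1, hc2, hc3, hc4⟩ := M.climb hA hr hcl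
      refine ⟨c', (reach_complete hun hur hsw).trans hc1, hc2, ?_⟩
      rw [hc3, hc4]
      simp [Config.triangles]
  · -- the current vertex has a child in the funnel
    left
    obtain ⟨v, hv⟩ : ∃ v, Lowest a σ (reg 3) (reg 2) v :=
      M.exists_lowest (M.xc_lt ((h5.2 (reg 3)).resolve_right (not_le.2 h6.lt)) (Ne.symm hun)) h5.1
    have hsw := M.sweep_lowest hR h6 h5 (Ne.symm hun) hv
    have hp := M.par_of_lowest h6 hv
    have hT := M.triangulates_insert h7 (consec_chain h6.lt) hv.1 hv.2.1 (h6.orient_lowest hv)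
    rw [← hp.chain_insert] at hT
    have hrun := reach_sweep (a := a) (h := h) (sw := sw) (tm := tm) (out := out) (tour := tour) hun hsw
    have htour := M.tourAt_descend hR h8 h6 hv
    have htri : ∀ (pc : ℕ) (reg' : Fin 6 → Fin k) (sw tm : ℕ) (tour : List (Fin k)),
        Config.triangles ⟨pc, reg', h, sw, tm, out ++ [(reg 2, reg 3, v)], tour⟩ =
          out.map (fun t => {t.1, t.2.1, t.2.2}) ++ [{reg 2, reg 3, v}] := by
      intros; simp [Config.triangles]
    simp only [Config.triangles] at hT h9 h10
    by_cases hvn : v = reg 4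
    · -- the child is the next vertex of the scan, hence a leaf
      have hcl : AtClimb a σ r s ⟨3, Function.update (Function.update reg 5 v) 2 (reg 4), h, sw + 1,
          tm + 3 + 3, out ++ [(reg 2, reg 3, v)], tour ++ [v]⟩ := by
        subst hvn
        refine ⟨rfl, h2, h3, h4, hp, ?_, htour.finish h5, ?_, ?_⟩
        · rw [htri, ← M.chain_finish hp h5] at *
          exact hT
        · rw [htri]; simp at h9 ⊢; omega
        · rw [htri]; simp at h10 ⊢; omega
      obtain ⟨c', hc1, hc2, hc3, hc4⟩ := M.climb hA hr hcl
      refine ⟨c', (hrun.trans (reach_leaf hvn)).trans hc1, hc2, ?_⟩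
      rw [hc3, hc4, htri]
      simp [Config.triangles]
      omega
    · refine ⟨_, hrun.trans (reach_descend hvn), ⟨rfl, h2, h3, h4, h5, M.funnel_of_lowest h6 hv,
        fun e => absurd e.symm hvn, ?_, htour, ?_, ?_⟩, ?_⟩
      · rw [htri]; exact hT
      · rw [htri]; simp at h9 ⊢; omega
      · rw [htri]; simp at h10 ⊢; omega
      · rw [htri]; simp [Config.triangles]

/-- On every mountain the program halts after a complete scan and a linear number of steps, with a
triangulation as its output and the Euler tour as the sequence of its visits. -/
theorem program_correct {k : ℕ} [NeZero k] {a : Fin k → Plane} (ha : IsMountain a)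
    (hg : InGeneralPosition a) :
    ∃ c : Config 6 k, HaltsAt program a c ∧ c.head = Fin.rev 0 ∧ c.sweeps ≤ 13 * k ∧
      c.time ≤ 13 * k ∧ c.triangles.Nodup ∧ IsTriangulation a {t | t ∈ c.triangles} ∧
      IsEulerTour a (root a) c.tour := by
  obtain ⟨σ, M, hB, hA⟩ := ha.exists_upright hg
  have hR := M.region_eq hB
  have hr : ccw a (Fin.rev 0) = root a := rfl
  -- every triangle has added a vertex to the chain
  have hcard : ∀ {C : Set (Fin k)} {T : List (Finset (Fin k))},
      Triangulates a σ (root a) (scanStart a) C T → T.length + 2 ≤ k := by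
    intro C T hT
    rw [← hT.card_chain]
    simpa using Set.ncard_le_ncard (Set.subset_univ C) Set.finite_univ
  have hloop : ∀ (n : ℕ) (c : Config 6 k), AtVertex a σ (root a) (scanStart a) c →
      2 * k ≤ n + (c.head.val + c.triangles.length) →
      ∃ c', Reach a c c' ∧ c'.pc = 19 ∧ c'.head = Fin.rev 0 ∧
        Triangulates a σ (root a) (scanStart a) Set.univ c'.triangles ∧
        IsEulerTour a (root a) c'.tour ∧
        c'.sweeps ≤ c'.head + c'.triangles.length ∧
        c'.time ≤ 7 * c'.head + 6 * c'.triangles.length := by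
    intro n
    induction n with
    | zero =>
      intro c hc hn
      have := hcard hc.triangulates
      have := c.head.isLt
      omega
    | succ n ih =>
      intro c hc hn
      rcases M.run_vertex hR hA hr hc with ⟨c', h1, h2, h3⟩ | h
      · obtain ⟨c'', h4, h5⟩ := ih c' h2 (by omega)
        exact ⟨c'', h1.trans h4, h5⟩
      · exact h
  obtain ⟨reg, h0, hr0, hr1, hr2, hr3⟩ := reach_start a
  have hstart : AtClimb a σ (root a) (scanStart a)
      ⟨3, reg, 0, 0, 3, [], [root a, scanStart a]⟩ := by
    refine ⟨rfl, hr0, hr1, hr2, ?_, ?_, ?_, by simp, by simp⟩ <;> simp only [hr2, hr3]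
    · exact M.par_base
    · exact M.triangulates_base M.mem_chain_base
    · exact M.tourAfter_start hR
  obtain ⟨c, h1, h2, -, -⟩ := M.climb hA hr hstart
  obtain ⟨c', h3, h4, h5, h6, h7, h8, h9⟩ := hloop (2 * k) c h2 (by omega)
  have hT := hcard h6
  have hk := c'.head.isLt
  obtain ⟨i, hi⟩ := Fin.exists_ne_and_ne_of_two_lt (root a) (scanStart a) ha.simple.three_le
  refine ⟨c', ⟨(h0.trans h1).trans h3, by rw [h4]; rfl⟩, h5, by omega, by omega, h6.nodup,
    M.isTriangulation h6 hR.symm ⟨i, Set.mem_univ i, hi⟩, h7⟩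

end Mountain

theorem mainTheorem1 :
    ∃ (m : ℕ) (P : Mountain.Program m) (C : ℕ),
      ∀ (k : ℕ) [NeZero k] (a : Fin k → Mountain.Plane),
        Mountain.IsMountain a → Mountain.InGeneralPosition a →
          ∃ c : Mountain.Config m k,
            Mountain.HaltsAt P a c ∧
            c.head = Fin.rev 0 ∧
            c.sweeps ≤ C * k ∧
            c.time ≤ C * k ∧
            c.triangles.Nodup ∧
            Mountain.IsTriangulation a {t | t ∈ c.triangles} ∧
            Mountain.IsEulerTour a (Mountain.root a) c.tour := by
  exact ⟨6, Mountain.program, 13, fun _ _ _ => Mountain.program_correct⟩
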